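/- Let $r$ be a positive integer and let $A=A_r$ be the (unital, associative) ring freely generated by symbols $\rho_0,\dots,\rho_r,\sigma_0,\dots,\sigma_r$ subject to the relations $\rho_j\sigma_i=1$ if $i=j$, $\rho_j\sigma_i=0$ if $i\neq j$, and $\sum_{i=0}^r\sigma_i\rho_i=1$. All $A$-modules are right $A$-modules. Let $\hat A=\varprojlim_{n\ge 1}A/nA$ be the $\mathbb Z$-adic completion of $A$. Call an $A$-submodule $G$ of $\hat A$ a *Corner group* for $A$ if $G$ is countable and torsion-free, $G$ is the pure closure $\{x\in\hat A : nx\in G_1 \text{ for some integer } n\geq 1\}$ of a free $A$-submodule $G_1=\bigoplus_{i\in I}e_iA\oplus 1A$ of $\hat A$ having a basis that contains (the image of) $1$, and $\operatorname{End}(G)=A$, that is, every endomorphism of the abelian group $G$ is of the form $g\mapsto ga$ for a unique $a\in A$. A Corner group for $A$ exists. Moreover, every Corner group $G$ for $A$ has the following properties. (1) There are countable free $A$-modules $B\subseteq H$ such that $G\cong H/B$ as $A$-modules, and $B$ is the union $\bigcup_{n\in\omega}B_n$ of an increasing chain of free $A$-submodules with $B_0=0$ such that for all $n\in\omega$, $H/B_n$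 and $B_{n+1}/B_n$ are free $A$-modules of rank $\omega$ (that is, with a countably infinite basis). (2) $\operatorname{Hom}(G,\mathbb Z)=0$. (3) For any positive integers $m$ and $k$ with $m\not\equiv k \pmod r$, the abelian groups $G^m\oplus\mathbb Z^{(\omega)}$ and $G^k\oplus\mathbb Z^{(\omega)}$ are not isomorphic. -/

import Mathlib

open MulOpposite

/-- The generators `ρ_0, …, ρ_r, σ_0, …, σ_r`. -/
inductive CornerGen (r : ℕ) : Type
  | rho (i : Fin (r + 1)) : CornerGen r
  | sigma (i : Fin (r + 1)) : CornerGen r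

/-- The defining relations `ρ_j σ_i = 1` if `i = j`, `ρ_j σ_i = 0` if `i ≠ j`,
and `∑ σ_i ρ_i = 1`, on the free (noncommutative, unital) ring on the generators. -/
inductive CornerRel (r : ℕ) :
    FreeAlgebra ℤ (CornerGen r) → FreeAlgebra ℤ (CornerGen r) → Prop
  | rho_sigma (i j : Fin (r + 1)) :
      CornerRel r
        (FreeAlgebra.ι ℤ (CornerGen.rho j) * FreeAlgebra.ι ℤ (CornerGen.sigma i))
        (if i = j then 1 else 0)
  | sum_sigma_rho :
      CornerRel r
        (∑ i : Fin (r + 1),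
          FreeAlgebra.ι ℤ (CornerGen.sigma i) * FreeAlgebra.ι ℤ (CornerGen.rho i))
        1

/-- Corner's ring `A_r`: the ring freely generated by the `ρ_i`, `σ_i` subject to the relations. -/
def CornerRing (r : ℕ) : Type := RingQuot (CornerRel r)

instance (r : ℕ) : Ring (CornerRing r) := inferInstanceAs (Ring (RingQuot (CornerRel r)))

section Completion

variable (S : Type*) [Ring S] (M : Type*) [AddCommGroup M] [Module S M]

/-- The submodule `n M` of `M`. -/
def nMul (n : ℕ) : Submodule S M := LinearMap.range (n • (LinearMap.id : M →ₗ[S] M))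

theorem nMul_le_of_dvd {m n : ℕ} (h : m ∣ n) : nMul S M n ≤ nMul S M m := by
  obtain ⟨c, rfl⟩ := h
  rintro _ ⟨x, rfl⟩
  exact ⟨c • x, by simp [mul_smul]⟩

/-- The `ℤ`-adic (natural) completion of `M`: the inverse limit of the quotients `M / n M` over the
positive integers `n` ordered by divisibility, realized as the submodule of compatible families. -/
def ZAdicCompletion : Submodule S ((n : ℕ+) → M ⧸ nMul S M n) where
  carrier := {x | ∀ (m n : ℕ+) (h : (m : ℕ) ∣ (n : ℕ)),
    Submodule.factor (nMul_le_of_dvd S M h) (x n) = x m}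
  add_mem' hx hy m n h := by simp [hx m n h, hy m n h]
  zero_mem' m n h := by simp
  smul_mem' s x hx m n h := by simp [hx m n h]

/-- The canonical map from `M` to its `ℤ`-adic completion. -/
def ZAdicCompletion.of : M →ₗ[S] ZAdicCompletion S M where
  toFun x := ⟨fun n => (nMul S M n).mkQ x, fun m n h => by simp⟩
  map_add' x y := by ext n; simp
  map_smul' s x := by ext n; simp

variable {S M}

/-- The pure closure `⟨N⟩_*` of a submodule `N` (of a torsion-free module): all elements having a
positive integer multiple in `N`. -/
def pureClosure (N : Submodule S M) : Submodule S M where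
  carrier := {x | ∃ n : ℕ, 0 < n ∧ n • x ∈ N}
  add_mem' := by
    rintro x y ⟨m, hm, hx⟩ ⟨n, hn, hy⟩
    refine ⟨m * n, Nat.mul_pos hm hn, ?_⟩
    rw [smul_add]
    refine N.add_mem ?_ ?_
    · rw [mul_comm, mul_smul]; exact N.nsmul_mem hx n
    · rw [mul_smul]; exact N.nsmul_mem hy m
  zero_mem' := ⟨1, one_pos, by simp⟩
  smul_mem' := by
    rintro s x ⟨n, hn, hx⟩
    refine ⟨n, hn, ?_⟩
    rw [smul_comm]
    exact N.smul_mem s hx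

end Completion

/-- `M` is a free `S`-module of rank `ω`, i.e. it has a countably infinite basis. -/
def IsFreeOfRankOmega (S : Type*) [Ring S] (M : Type*) [AddCommGroup M] [Module S M] : Prop :=
  Nonempty (Module.Basis ℕ S M)

/-- The `ℤ`-adic completion of `A = A_r`, as a right `A`-module (a module over `Aᵐᵒᵖ`). -/
abbrev CornerHat (r : ℕ) :=
  ZAdicCompletion (CornerRing r)ᵐᵒᵖ (CornerRing r)

/-- The image of `1 ∈ A` in the completion of `A`. -/
def CornerHat.one (r : ℕ) : CornerHat r :=
  ZAdicCompletion.of (CornerRing r)ᵐᵒᵖ (CornerRing r) 1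

/-- `G` is a Corner group for `A = A_r`: a countable torsion-free group which is the pure closure,
in the `ℤ`-adic completion of `A`, of a free right `A`-module `⨁ e_i A ⊕ A` (with a basis `E`
containing `1`), and whose endomorphism ring as an abelian group is `A`: each additive endomorphism
is `g ↦ g a` for a unique `a ∈ A`. (Endomorphisms act on the right; as `AddMonoid.End` composes maps
acting on the left, the identification is a ring isomorphism from `Aᵐᵒᵖ`.) -/
structure IsCornerGroup (r : ℕ) (G : Submodule (CornerRing r)ᵐᵒᵖ (CornerHat r)) : Prop where
  countable : Countable G
  torsionFree : IsAddTorsionFree G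
  eq_pureClosure : ∃ E : Set (CornerHat r), CornerHat.one r ∈ E ∧
    LinearIndepOn (CornerRing r)ᵐᵒᵖ id E ∧
    G = pureClosure (Submodule.span (CornerRing r)ᵐᵒᵖ E)
  end_eq : Function.Bijective (Module.toAddMonoidEnd (CornerRing r)ᵐᵒᵖ G)

/-!
Corner groups for the ring `A = A_r` exist, are countable direct limits of free modules, admit no
nonzero homomorphism to `ℤ`, and their finite powers remember the exponent modulo `r` even after
adding a free group of countable rank.

**The ring.** `A` acts on functions on a set `X` with a bijection `X ≃ (Fin (r + 1)) × X`; grading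
the action by degree yields an additive functional `ε : A → ℤ` with `ε(1) = 1` that vanishes on the
nonempty words in the `σ_i` and on those in the `ρ_i` (`CornerRing.eps`). Everything needed about
`A` follows from `ε`. First, additive functionals `A → ℤ` separate points
(`CornerRing.eq_zero_of_forall_hom`): right multiplication by long words in the `σ_i` moves any
element into the span of such words, which are orthonormal for a pairing defined by `ε`. Secondly,
with `Φ(a) = ∑ ρ_i a σ_i` one has `Φ(a ρ_i) = ρ_i a` and `Φ(σ_i a) = a σ_i`, and the residue of
`ε(Φⁿ a)` modulo `r` is eventually constant; its eventual value is a trace `A → ℤ / r` with value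
`1` at `1` (`CornerRing.exists_trace`).

**Existence.** Choose `2`-adic integers `α_c, β_c` (`c ∈ A`), algebraically independent over `ℤ`,
and let `G` be the pure closure of the module generated by `1` and all `e_c = α_c 1 + β_c c`. An
endomorphism `θ` of `G` is continuous, so `θ(e_a) = α_a θ(1) + β_a θ(a)`. All three values have a
multiple that is affine in the `α_c, β_c`; extending the functionals of `A` to the completion and
comparing coefficients of quadratic and linear monomials gives `θ(1) ∈ A` and `θ(a) = a θ(1)`
(`CornerHat.endo_of`), and density of `A` does the rest. Only the degree two part of algebraic
independence is used.

**Presentation.** In an arbitrary Corner group with basis `{1} ∪ {e}`, write `e = a + n! y` with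
`a ∈ A`. The elements `1` and `y` span free modules that increase with `n` and exhaust `G`
(`IsCornerGroup.exists_chain`). The usual mapping telescope of this chain, padded by free summands
that die after one step, presents `G` as `H / B` (`exists_telescope`).

**Homomorphisms to `ℤ` and powers.** If `f : G → ℤ`, then `g ↦ f(g) 1` is multiplication by an
element of `A`, which is the integer `f(1)`; comparing with `σ_0` gives `f = 0`. Hence an
isomorphism `G^m ⊕ ℤ^(ω) ≃ G^k ⊕ ℤ^(ω)` restricts to `G^m ≃ G^k`, that is, to a pair of mutually
inverse rectangular matrices over `End G`, and the trace gives `m ≡ k` modulo `r`.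
-/

/-! ### Generators, relations and induction -/

namespace CornerRing

variable {r : ℕ}

/-- The generator `ρ_i` of Corner's ring. -/
def rho (i : Fin (r + 1)) : CornerRing r :=
  RingQuot.mkRingHom (CornerRel r) (FreeAlgebra.ι ℤ (CornerGen.rho i))

/-- The generator `σ_i` of Corner's ring. -/
def sigma (i : Fin (r + 1)) : CornerRing r :=
  RingQuot.mkRingHom (CornerRel r) (FreeAlgebra.ι ℤ (CornerGen.sigma i))

theorem rho_mul_sigma (i j : Fin (r + 1)) :
    rho j * sigma i = if i = j then (1 : CornerRing r) else 0 := by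
  have h := RingQuot.mkRingHom_rel (CornerRel.rho_sigma (r := r) i j)
  rw [map_mul] at h
  refine Eq.trans h ?_
  split_ifs
  · exact map_one _
  · exact map_zero _

theorem sum_sigma_mul_rho : ∑ i : Fin (r + 1), sigma i * rho i = (1 : CornerRing r) := by
  have h := RingQuot.mkRingHom_rel (CornerRel.sum_sigma_rho (r := r))
  rw [map_sum, map_one] at h
  refine Eq.trans (Finset.sum_congr rfl fun i _ => ?_) h
  exact (map_mul _ _ _).symm

@[elab_as_elim]
theorem induction {P : CornerRing r → Prop} (int : ∀ n : ℤ, P n) (rho : ∀ i, P (rho i))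
    (sigma : ∀ i, P (sigma i)) (add : ∀ a b, P a → P b → P (a + b))
    (mul : ∀ a b, P a → P b → P (a * b)) (a : CornerRing r) : P a := by
  obtain ⟨x, rfl⟩ := RingQuot.mkRingHom_surjective (CornerRel r) a
  induction x using FreeAlgebra.induction with
  | grade0 n =>
    have : RingQuot.mkRingHom (CornerRel r) (algebraMap ℤ (FreeAlgebra ℤ (CornerGen r)) n) =
        (n : RingQuot (CornerRel r)) := by simp
    rw [this]
    exact int n
  | grade1 x =>
    cases x with
    | rho i => exact rho i
    | sigma i => exact sigma i
  | mul a b ha hb => rw [map_mul]; exact mul _ _ ha hb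
  | add a b ha hb => rw [map_add]; exact add _ _ ha hb

instance : Countable (CornerGen r) := by
  refine Function.Surjective.countable
    (f := fun x : Fin (r + 1) ⊕ Fin (r + 1) => Sum.elim CornerGen.rho CornerGen.sigma x) ?_
  rintro (i | i)
  · exact ⟨Sum.inl i, rfl⟩
  · exact ⟨Sum.inr i, rfl⟩

instance : Countable (CornerRing r) := by
  have : Countable (FreeAlgebra ℤ (CornerGen r)) := by
    rw [← Cardinal.mk_le_aleph0_iff]
    refine (FreeAlgebra.cardinalMk_le_max ℤ (CornerGen r)).trans ?_
    simp
  exact (RingQuot.mkRingHom_surjective (CornerRel r)).countable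

/-! ### A representation graded by degree -/

/-- `σ_i` as an operator on functions `ℕ × ℤ → ℤ`: the first coordinate is a word in base `r + 1`
with last digit first, the second one is a degree. -/
def sigmaOp (i : Fin (r + 1)) : Module.End ℤ (ℕ × ℤ → ℤ) where
  toFun f := fun x => if x.1 % (r + 1) = i then f (x.1 / (r + 1), x.2 - 1) else 0
  map_add' f g := by ext x; simp only [Pi.add_apply]; split_ifs <;> simp
  map_smul' c f := by ext x; simp

/-- `ρ_i` as an operator on functions `ℕ × ℤ → ℤ`. -/
def rhoOp (i : Fin (r + 1)) : Module.End ℤ (ℕ × ℤ → ℤ) where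
  toFun f := fun x => f ((r + 1) * x.1 + i, x.2 + 1)
  map_add' f g := by ext x; simp
  map_smul' c f := by ext x; simp

/-- The action of Corner's ring on functions `ℕ × ℤ → ℤ`. -/
def rep (r : ℕ) : CornerRing r →+* Module.End ℤ (ℕ × ℤ → ℤ) :=
  RingQuot.lift ⟨((FreeAlgebra.lift ℤ (fun g : CornerGen r => match g with
    | .rho i => rhoOp i
    | .sigma i => sigmaOp i)) : FreeAlgebra ℤ (CornerGen r) →+* Module.End ℤ (ℕ × ℤ → ℤ)), by
    intro x y h
    cases h with
    | rho_sigma i j =>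
      simp only [RingHom.coe_coe, map_mul, FreeAlgebra.lift_ι_apply]
      ext f x
      have h1 : ((r + 1) * x.1 + (j : ℕ)) % (r + 1) = j := by
        rw [Nat.mul_add_mod, Nat.mod_eq_of_lt j.2]
      have h2 : ((r + 1) * x.1 + (j : ℕ)) / (r + 1) = x.1 := by
        rw [Nat.mul_add_div (Nat.succ_pos r), Nat.div_eq_of_lt j.2, add_zero]
      by_cases h : i = j
      · subst h
        simp [rhoOp, sigmaOp, h1, h2]
      · have h' : ¬ ((j : ℕ) = i) := fun h' => h (Fin.ext h'.symm)
        simp [rhoOp, sigmaOp, h1, h, h']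
    | sum_sigma_rho =>
      simp only [RingHom.coe_coe, map_mul, map_sum, map_one, FreeAlgebra.lift_ι_apply]
      ext f x
      simp only [LinearMap.sum_apply, Finset.sum_apply, Module.End.mul_apply, Module.End.one_apply,
        rhoOp, sigmaOp, LinearMap.coe_mk, AddHom.coe_mk, sub_add_cancel]
      rw [Finset.sum_eq_single ⟨x.1 % (r + 1), Nat.mod_lt _ (Nat.succ_pos r)⟩]
      · simp [Nat.div_add_mod]
      · intro i _ hi
        rw [if_neg]
        rintro h
        exact hi (Fin.ext h.symm)
      · simp⟩

theorem rep_rho (i : Fin (r + 1)) : rep r (rho i) = rhoOp i := by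
  refine (RingQuot.lift_mkRingHom_apply _ _ _).trans ?_
  simp

theorem rep_sigma (i : Fin (r + 1)) : rep r (sigma i) = sigmaOp i := by
  refine (RingQuot.lift_mkRingHom_apply _ _ _).trans ?_
  simp

/-- The product `σ_{i_1} ⋯ σ_{i_n}`. -/
def sigmaWord (l : List (Fin (r + 1))) : CornerRing r := (l.map sigma).prod

/-- The product `ρ_{i_1} ⋯ ρ_{i_n}`. -/
def rhoWord (l : List (Fin (r + 1))) : CornerRing r := (l.map rho).prod

@[simp] theorem sigmaWord_nil : sigmaWord ([] : List (Fin (r + 1))) = 1 := rfl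

@[simp] theorem rhoWord_nil : rhoWord ([] : List (Fin (r + 1))) = 1 := rfl

@[simp] theorem sigmaWord_cons (i : Fin (r + 1)) (l) :
    sigmaWord (i :: l) = sigma i * sigmaWord l := by simp [sigmaWord]

@[simp] theorem rhoWord_cons (i : Fin (r + 1)) (l) :
    rhoWord (i :: l) = rho i * rhoWord l := by simp [rhoWord]

theorem sigmaWord_append (l l' : List (Fin (r + 1))) :
    sigmaWord (l ++ l') = sigmaWord l * sigmaWord l' := by simp [sigmaWord]

theorem rhoWord_append (l l' : List (Fin (r + 1))) :
    rhoWord (l ++ l') = rhoWord l * rhoWord l' := by simp [rhoWord]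

/-- An additive functional of degree zero: the value at `(0, 0)` of the function obtained by acting
on the indicator function of degree zero. -/
def eps (r : ℕ) : CornerRing r →+ ℤ where
  toFun a := rep r a (fun x => if x.2 = 0 then 1 else 0) (0, 0)
  map_zero' := by simp
  map_add' a b := by simp

theorem eps_one : eps r 1 = 1 := by simp [eps]

theorem eps_sigmaWord {l : List (Fin (r + 1))} (hl : l ≠ []) : eps r (sigmaWord l) = 0 := by
  have key : ∀ (l : List (Fin (r + 1))) (x : ℕ) (n : ℤ), n ≠ l.length →
      rep r (sigmaWord l) (fun x => if x.2 = 0 then 1 else 0) (x, n) = 0 := by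
    intro l
    induction l with
    | nil => intro x n h; simpa using h
    | cons i l ih =>
      intro x n h
      rw [sigmaWord_cons, map_mul, rep_sigma]
      simp only [sigmaOp, Module.End.mul_apply, LinearMap.coe_mk, AddHom.coe_mk]
      rw [ih _ _ (by simp at h; omega), ite_self]
  refine key l 0 0 ?_
  have := List.length_pos_of_ne_nil hl
  omega

theorem eps_rhoWord {l : List (Fin (r + 1))} (hl : l ≠ []) : eps r (rhoWord l) = 0 := by
  have key : ∀ (l : List (Fin (r + 1))) (x : ℕ) (n : ℤ), n + l.length ≠ 0 →
      rep r (rhoWord l) (fun x => if x.2 = 0 then 1 else 0) (x, n) = 0 := by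
    intro l
    induction l with
    | nil => intro x n h; simpa using h
    | cons i l ih =>
      intro x n h
      rw [rhoWord_cons, map_mul, rep_rho]
      simp only [rhoOp, Module.End.mul_apply, LinearMap.coe_mk, AddHom.coe_mk]
      rw [ih _ _ (by simp at h; omega)]
  refine key l 0 0 ?_
  have := List.length_pos_of_ne_nil hl
  omega

/-! ### Monomials and separation by functionals -/

/-- The additive subgroup spanned by the words in the `σ_i`. -/
def sigmaSpan (r : ℕ) : AddSubgroup (CornerRing r) := AddSubgroup.closure (Set.range sigmaWord)

/-- Corner's ring is additively spanned by the monomials `σ_I ρ_J`. -/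
theorem closure_monomials : AddSubgroup.closure
    (Set.range fun p : List (Fin (r + 1)) × List (Fin (r + 1)) =>
      sigmaWord p.1 * rhoWord p.2) = ⊤ := by
  set M := AddSubgroup.closure (Set.range fun p : List (Fin (r + 1)) × List (Fin (r + 1)) =>
      sigmaWord p.1 * rhoWord p.2) with hM
  have mem : ∀ I J, sigmaWord I * rhoWord J ∈ M := fun I J =>
    AddSubgroup.subset_closure ⟨(I, J), rfl⟩
  have ext : ∀ a : CornerRing r, (∀ I J, a * (sigmaWord I * rhoWord J) ∈ M) →
      ∀ m ∈ M, a * m ∈ M := by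
    intro a ha m hm
    induction hm using AddSubgroup.closure_induction with
    | mem x hx => obtain ⟨p, rfl⟩ := hx; exact ha _ _
    | zero => simp
    | add x y _ _ hx hy => rw [mul_add]; exact M.add_mem hx hy
    | neg x _ hx => rw [mul_neg]; exact M.neg_mem hx
  have key : ∀ a : CornerRing r, ∀ m ∈ M, a * m ∈ M := by
    intro a
    induction a using CornerRing.induction with
    | int n => intro m hm; rw [← zsmul_eq_mul]; exact M.zsmul_mem hm n
    | rho i =>
      refine ext _ fun I J => ?_
      cases I with
      | nil => simpa using mem [] (i :: J)
      | cons j I =>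
        rw [sigmaWord_cons, ← mul_assoc, ← mul_assoc, rho_mul_sigma]
        split_ifs
        · simpa using mem I J
        · simp
    | sigma i =>
      refine ext _ fun I J => ?_
      simpa [mul_assoc] using mem (i :: I) J
    | add a b ha hb => intro m hm; rw [add_mul]; exact M.add_mem (ha m hm) (hb m hm)
    | mul a b ha hb => intro m hm; rw [mul_assoc]; exact ha _ (hb _ hm)
  refine eq_top_iff.2 fun a _ => ?_
  have := key a 1 (by simpa using mem [] [])
  simpa using this

theorem rhoWord_mul_sigmaWord_mem (J : List (Fin (r + 1))) :
    ∀ K : List (Fin (r + 1)), J.length ≤ K.length → rhoWord J * sigmaWord K ∈ sigmaSpan r := by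
  induction J using List.reverseRecOn with
  | nil =>
    intro K _
    rw [rhoWord_nil, one_mul]
    exact AddSubgroup.subset_closure ⟨K, rfl⟩
  | append_singleton J j ih =>
    intro K hK
    cases K with
    | nil => simp at hK
    | cons k K =>
      rw [rhoWord_append, sigmaWord_cons, mul_assoc, ← mul_assoc _ (sigma k)]
      simp only [rhoWord_cons, rhoWord_nil, mul_one, rho_mul_sigma]
      split_ifs
      · rw [one_mul]; exact ih K (by simpa using hK)
      · simp [zero_mem]

/-- Multiplying on the right by a sufficiently long word in the `σ_i` removes all the `ρ_j`. -/
theorem exists_mul_sigmaWord_mem (a : CornerRing r) :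
    ∃ N : ℕ, ∀ K : List (Fin (r + 1)), N ≤ K.length → a * sigmaWord K ∈ sigmaSpan r := by
  have ha : a ∈ AddSubgroup.closure
    (Set.range fun p : List (Fin (r + 1)) × List (Fin (r + 1)) =>
      sigmaWord p.1 * rhoWord p.2) := by rw [closure_monomials]; trivial
  induction ha using AddSubgroup.closure_induction with
  | mem x hx =>
    obtain ⟨⟨I, J⟩, rfl⟩ := hx
    refine ⟨J.length, fun K hK => ?_⟩
    rw [mul_assoc]
    have hJK := rhoWord_mul_sigmaWord_mem J K hK
    generalize rhoWord J * sigmaWord K = y at hJK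
    dsimp only
    induction hJK using AddSubgroup.closure_induction with
    | mem x hx =>
      obtain ⟨L, rfl⟩ := hx
      rw [← sigmaWord_append]
      exact AddSubgroup.subset_closure ⟨_, rfl⟩
    | zero => simp [zero_mem]
    | add x y _ _ hx hy => rw [mul_add]; exact add_mem hx hy
    | neg x _ hx => rw [mul_neg]; exact neg_mem hx
  | zero => exact ⟨0, fun K _ => by simp [zero_mem]⟩
  | add x y _ _ hx hy =>
    obtain ⟨N, hN⟩ := hx
    obtain ⟨N', hN'⟩ := hy
    exact ⟨max N N', fun K hK => by
      rw [add_mul]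
      exact add_mem (hN K (le_trans (le_max_left _ _) hK)) (hN' K (le_trans (le_max_right _ _) hK))⟩
  | neg x _ hx =>
    obtain ⟨N, hN⟩ := hx
    exact ⟨N, fun K hK => by rw [neg_mul]; exact neg_mem (hN K hK)⟩

/-- The words in the `σ_i` are orthonormal for the pairing `(I, L) ↦ eps (ρ_I^* σ_L)`. -/
theorem eps_rhoWord_mul_sigmaWord (I : List (Fin (r + 1))) :
    ∀ L : List (Fin (r + 1)),
      eps r (rhoWord I.reverse * sigmaWord L) = if I = L then 1 else 0 := by
  induction I with
  | nil =>
    intro L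
    by_cases h : [] = L
    · subst h; simp [eps_one]
    · simp [h, eps_sigmaWord (Ne.symm h)]
  | cons i I ih =>
    intro L
    cases L with
    | nil => simp [eps_rhoWord]
    | cons j L =>
      rw [List.reverse_cons, rhoWord_append, sigmaWord_cons, mul_assoc, ← mul_assoc _ (sigma j)]
      simp only [rhoWord_cons, rhoWord_nil, mul_one, rho_mul_sigma]
      by_cases h : j = i
      · subst h; simp [ih]
      · simp [h, Ne.symm h]

/-- An element of the span of the words in the `σ_i` is determined by its coefficients, which are
values of `eps`. -/
theorem eq_zero_of_mem_sigmaSpan {b : CornerRing r} (hb : b ∈ sigmaSpan r)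
    (h : ∀ I, eps r (rhoWord I * b) = 0) : b = 0 := by
  obtain ⟨c, rfl⟩ : ∃ c : List (Fin (r + 1)) →₀ ℤ, c.sum (fun I n => n • sigmaWord I) = b := by
    rw [sigmaSpan, ← Submodule.span_int_eq_addSubgroupClosure] at hb
    exact (Finsupp.mem_span_range_iff_exists_finsupp (R := ℤ)).1 hb
  suffices hc : c = 0 by simp [hc]
  ext I
  have := h I.reverse
  simp only [Finsupp.sum, Finset.mul_sum, map_sum, mul_smul_comm, map_zsmul,
    eps_rhoWord_mul_sigmaWord] at this
  rw [Finset.sum_eq_single I] at this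
  · simpa [eps_rhoWord_mul_sigmaWord] using this
  · intro L _ hL
    simp [hL.symm]
  · intro hI
    simp [Finsupp.notMem_support_iff.1 hI]

/-- The words of length `n` in the `σ_i` have no common left annihilator, since `∑ σ_i ρ_i = 1`. -/
theorem eq_zero_of_mul_sigmaWord (n : ℕ) : ∀ a : CornerRing r,
    (∀ K : List (Fin (r + 1)), K.length = n → a * sigmaWord K = 0) → a = 0 := by
  induction n with
  | zero => intro a h; simpa using h [] rfl
  | succ n ih =>
    intro a h
    have h0 : ∀ i, a * sigma i = 0 := fun i => ih _ fun K hK => by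
      have := h (i :: K) (by simp [hK])
      rwa [sigmaWord_cons, ← mul_assoc] at this
    rw [← mul_one a, ← sum_sigma_mul_rho, Finset.mul_sum]
    exact Finset.sum_eq_zero fun i _ => by rw [← mul_assoc, h0, zero_mul]

/-- The additive functionals to `ℤ` separate the elements of Corner's ring. -/
theorem eq_zero_of_forall_hom {a : CornerRing r} (h : ∀ f : CornerRing r →+ ℤ, f a = 0) :
    a = 0 := by
  obtain ⟨N, hN⟩ := exists_mul_sigmaWord_mem a
  refine eq_zero_of_mul_sigmaWord N a fun K hK => ?_
  refine eq_zero_of_mem_sigmaSpan (hN K hK.ge) fun I => ?_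
  simpa using h (((eps r).comp (AddMonoidHom.mulLeft (rhoWord I))).comp
    (AddMonoidHom.mulRight (sigmaWord K)))

theorem torsionFree (n : ℕ) (hn : n ≠ 0) (a : CornerRing r) (h : n • a = 0) : a = 0 := by
  refine eq_zero_of_forall_hom fun f => ?_
  have := congrArg f h
  rw [map_nsmul, map_zero, smul_eq_zero] at this
  exact this.resolve_left hn

instance : Nontrivial (CornerRing r) :=
  ⟨1, 0, fun h => by simpa [eps_one] using congrArg (eps r) h⟩

/-- Corner's ring is reduced as an abelian group: it has no nonzero element divisible by all
positive integers. -/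
theorem eq_zero_of_forall_dvd {a : CornerRing r} (h : ∀ n : ℕ, 0 < n → ∃ b, a = n • b) :
    a = 0 := by
  refine eq_zero_of_forall_hom fun f => ?_
  obtain ⟨b, hb⟩ := h ((f a).natAbs + 1) (Nat.succ_pos _)
  refine Int.eq_zero_of_abs_lt_dvd (m := ((f a).natAbs + 1 : ℕ)) ⟨f b, ?_⟩ ?_
  · conv_lhs => rw [hb, map_nsmul]
    simp
  · simp

/-! ### A trace with values in `ℤ / r` -/

/-- The additive map `a ↦ ∑ ρ_i a σ_i`. -/
def phi (r : ℕ) : CornerRing r →+ CornerRing r :=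
  ∑ i : Fin (r + 1), (AddMonoidHom.mulLeft (rho i)).comp (AddMonoidHom.mulRight (sigma i))

theorem phi_apply (a : CornerRing r) : phi r a = ∑ i : Fin (r + 1), rho i * (a * sigma i) := by
  simp [phi, AddMonoidHom.finsetSum_apply]

theorem phi_mul_rho (a : CornerRing r) (i : Fin (r + 1)) : phi r (a * rho i) = rho i * a := by
  simp [phi_apply, mul_assoc, rho_mul_sigma]

theorem phi_sigma_mul (a : CornerRing r) (i : Fin (r + 1)) : phi r (sigma i * a) = a * sigma i := by
  simp only [phi_apply, ← mul_assoc, rho_mul_sigma, ite_mul, one_mul, zero_mul]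
  simp

theorem eps_phi_iterate_one (n : ℕ) : ((eps r ((phi r)^[n] 1) : ℤ) : ZMod r) = 1 := by
  have : (phi r)^[n] 1 = (r + 1) ^ n • 1 := by
    induction n with
    | zero => simp
    | succ n ih =>
      rw [Function.iterate_succ_apply', ih, map_nsmul, phi_apply, pow_succ, mul_smul]
      simp [rho_mul_sigma]
  rw [this, map_nsmul, eps_one]
  simp

/-- The values `ε(Φⁿ a)` are eventually constant modulo `r`. Indeed `Φ` removes the outer letters of
a monomial `σ_I ρ_J` until it vanishes or one of the words is empty; it rotates nonempty pure words,
on which `ε` vanishes, and `Φ(1) = r + 1`. -/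
theorem trace_stable (a : CornerRing r) : ∃ N : ℕ, ∀ n, N ≤ n →
    ((eps r ((phi r)^[n] a) : ℤ) : ZMod r) = ((eps r ((phi r)^[N] a) : ℤ) : ZMod r) := by
  have sig : ∀ l : List (Fin (r + 1)), l ≠ [] → ∀ n, eps r ((phi r)^[n] (sigmaWord l)) = 0 := by
    intro l hl n
    induction n generalizing l with
    | zero => simpa using eps_sigmaWord hl
    | succ n ih =>
      obtain ⟨i, l, rfl⟩ := List.exists_cons_of_ne_nil hl
      rw [Function.iterate_succ_apply, sigmaWord_cons, phi_sigma_mul]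
      have := ih (l ++ [i]) (by simp)
      simpa [sigmaWord_append] using this
  have rh : ∀ l : List (Fin (r + 1)), l ≠ [] → ∀ n, eps r ((phi r)^[n] (rhoWord l)) = 0 := by
    intro l hl n
    induction n generalizing l with
    | zero => simpa using eps_rhoWord hl
    | succ n ih =>
      obtain ⟨l, i, rfl⟩ := List.eq_nil_or_concat' l |>.resolve_left hl
      rw [Function.iterate_succ_apply, rhoWord_append]
      simp only [rhoWord_cons, rhoWord_nil, mul_one, phi_mul_rho]
      have := ih (i :: l) (by simp)
      simpa using this
  have ha : a ∈ AddSubgroup.closure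
    (Set.range fun p : List (Fin (r + 1)) × List (Fin (r + 1)) =>
      sigmaWord p.1 * rhoWord p.2) := by rw [closure_monomials]; trivial
  suffices h : ∃ N : ℕ, ∃ z : ZMod r, ∀ n, N ≤ n → ((eps r ((phi r)^[n] a) : ℤ) : ZMod r) = z by
    obtain ⟨N, z, h⟩ := h
    exact ⟨N, fun n hn => by rw [h n hn, h N le_rfl]⟩
  induction ha using AddSubgroup.closure_induction with
  | mem x hx =>
    obtain ⟨⟨I, J⟩, rfl⟩ := hx
    induction I generalizing J with
    | nil =>
      by_cases h : J = []
      · subst h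
        exact ⟨0, 1, fun n _ => by simpa using eps_phi_iterate_one n⟩
      · exact ⟨0, 0, fun n _ => by simp [rh J h n]⟩
    | cons i I ih =>
      cases J using List.reverseRecOn with
      | nil =>
        refine ⟨0, 0, fun n _ => ?_⟩
        dsimp only
        rw [rhoWord_nil, mul_one, sig (i :: I) (by simp) n, Int.cast_zero]
      | append_singleton J j =>
        obtain ⟨N, z, h⟩ := ih J
        refine ⟨N + 1, if i = j then z else 0, fun n hn => ?_⟩
        obtain ⟨n, rfl⟩ : ∃ k, n = k + 1 := ⟨n - 1, by omega⟩
        have e : phi r (sigmaWord (i :: I) * rhoWord (J ++ [j])) =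
            if i = j then sigmaWord I * rhoWord J else 0 := by
          rw [sigmaWord_cons, rhoWord_append, ← mul_assoc]
          simp only [rhoWord_cons, rhoWord_nil, mul_one, phi_mul_rho]
          rw [mul_assoc, ← mul_assoc, rho_mul_sigma]
          split_ifs <;> simp
        dsimp only
        rw [Function.iterate_succ_apply, e]
        split_ifs
        · exact h n (by omega)
        · simp [iterate_map_zero]
  | zero => exact ⟨0, 0, fun n _ => by simp [iterate_map_zero]⟩
  | add x y _ _ hx hy =>
    obtain ⟨N, z, hN⟩ := hx
    obtain ⟨N', z', hN'⟩ := hy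
    refine ⟨max N N', z + z', fun n hn => ?_⟩
    rw [iterate_map_add, map_add, Int.cast_add, hN n (le_trans (le_max_left _ _) hn),
      hN' n (le_trans (le_max_right _ _) hn)]
  | neg x _ hx =>
    obtain ⟨N, z, hN⟩ := hx
    refine ⟨N, -z, fun n hn => ?_⟩
    rw [iterate_map_neg, map_neg, Int.cast_neg, hN n hn]

/-- Corner's ring has a trace with values in `ℤ / r` taking the value `1` at the identity. -/
theorem exists_trace (r : ℕ) : ∃ T : CornerRing r →+ ZMod r,
    T 1 = 1 ∧ ∀ a b, T (a * b) = T (b * a) := by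
  choose N hN using trace_stable (r := r)
  have hT : ∀ a n, N a ≤ n → ((eps r ((phi r)^[n] a) : ℤ) : ZMod r) =
    ((eps r ((phi r)^[N a] a) : ℤ) : ZMod r) := hN
  let T : CornerRing r →+ ZMod r :=
    { toFun := fun a => ((eps r ((phi r)^[N a] a) : ℤ) : ZMod r)
      map_zero' := by simp [iterate_map_zero]
      map_add' := fun a b => by
        have h1 := hT (a + b) (N (a + b) + N a + N b) (by omega)
        have h2 := hT a (N (a + b) + N a + N b) (by omega)
        have h3 := hT b (N (a + b) + N a + N b) (by omega)
        rw [← h1, ← h2, ← h3, iterate_map_add, map_add, Int.cast_add] }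
  have shift : ∀ a b, phi r a = b → T a = T b := by
    intro a b h
    have h1 := hT a (N a + N b + 1) (by omega)
    have h2 := hT b (N a + N b) (by omega)
    rw [Function.iterate_succ_apply, h] at h1
    exact h1.symm.trans h2
  refine ⟨T, ?_, fun a => ?_⟩
  · exact eps_phi_iterate_one _
  · induction a using CornerRing.induction with
    | int n => intro b; rw [(Int.cast_commute n b).eq]
    | rho i => intro b; exact (shift _ _ (phi_mul_rho b i)).symm
    | sigma i => intro b; exact shift _ _ (phi_sigma_mul b i)
    | add a a' h h' => intro b; rw [add_mul, mul_add, map_add, map_add, h, h']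
    | mul a a' h h' => intro b; rw [mul_assoc, h, mul_assoc, h', mul_assoc]

end CornerRing

/-! ### The `ℤ`-adic completion of a torsion-free module -/

namespace ZAdicCompletion

variable {S : Type*} [Ring S] {M : Type*} [AddCommGroup M] [Module S M]

theorem mem_nMul {n : ℕ} {a : M} : a ∈ nMul S M n ↔ ∃ b, n • b = a := by
  simp [nMul, LinearMap.mem_range]

theorem ext_apply {x y : ZAdicCompletion S M} (h : ∀ n, x.1 n = y.1 n) : x = y :=
  Subtype.ext (funext h)

theorem of_apply (a : M) (n : ℕ+) : (of S M a).1 n = (nMul S M n).mkQ a := rfl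

theorem nsmul_apply_self (n : ℕ+) (y : ZAdicCompletion S M) : ((n : ℕ) • y).1 n = 0 := by
  obtain ⟨a, ha⟩ := (nMul S M n).mkQ_surjective (y.1 n)
  change (n : ℕ) • y.1 n = 0
  rw [← ha, ← map_nsmul, Submodule.mkQ_apply, Submodule.Quotient.mk_eq_zero]
  exact mem_nMul.2 ⟨a, rfl⟩

theorem eq_zero_of_forall_dvd {x : ZAdicCompletion S M}
    (h : ∀ n : ℕ, 0 < n → ∃ y, x = n • y) : x = 0 := by
  refine ext_apply fun n => ?_
  obtain ⟨y, rfl⟩ := h n n.pos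
  exact nsmul_apply_self n y

/-- The topology of the completion induces the `ℤ`-adic topology on `M`. -/
theorem exists_nsmul_of_of_eq {n : ℕ} (hn : 0 < n) {a : M} {y : ZAdicCompletion S M}
    (h : of S M a = n • y) : ∃ b, a = n • b := by
  lift n to ℕ+ using hn
  have h1 : (of S M a).1 n = 0 := by rw [h]; exact nsmul_apply_self n y
  rw [of_apply, Submodule.mkQ_apply, Submodule.Quotient.mk_eq_zero] at h1
  obtain ⟨b, hb⟩ := mem_nMul.1 h1
  exact ⟨b, hb.symm⟩

section TorsionFree

variable (htf : ∀ n : ℕ, n ≠ 0 → ∀ a : M, n • a = 0 → a = 0)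
include htf

/-- The kernel of the projection of the completion to `M ⧸ nM` consists of the multiples of `n`. -/
theorem exists_eq_nsmul {x : ZAdicCompletion S M} {n : ℕ+} (hx : x.1 n = 0) :
    ∃ y, x = (n : ℕ) • y := by
  -- the component of `x` at `n * m` is divisible by `n`; the quotient is well defined modulo `m`
  choose a ha using fun m : ℕ+ => (nMul S M ((n * m : ℕ+) : ℕ)).mkQ_surjective (x.1 (n * m))
  have hb : ∀ m, ∃ b, (n : ℕ) • b = a m := fun m => by
    have h1 := x.2 n (n * m) (by simp)
    rw [hx, ← ha m] at h1
    exact mem_nMul.1 ((Submodule.Quotient.mk_eq_zero _).1 h1)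
  choose b hb using hb
  refine ⟨⟨fun m => (nMul S M m).mkQ (b m), fun m m' h => ?_⟩, ext_apply fun m => ?_⟩
  · have h1 := x.2 (n * m) (n * m') (by simpa using Nat.mul_dvd_mul_left _ h)
    rw [← ha m, ← ha m'] at h1
    have h2 := (Submodule.Quotient.eq _).1 h1
    obtain ⟨c, hc⟩ := mem_nMul.1 h2
    refine (Submodule.Quotient.eq _).2 (mem_nMul.2 ⟨c, ?_⟩)
    rw [LinearMap.id_apply, ← hb m, ← hb m', ← smul_sub, PNat.mul_coe, mul_smul] at hc
    have h3 := htf n n.ne_zero ((m : ℕ) • c - (b m' - b m)) (by rw [smul_sub, hc, sub_self])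
    simpa [sub_eq_zero] using h3
  · have h1 := x.2 m (n * m) (by simp)
    rw [← h1, ← ha m, ← hb m]
    change _ = (n : ℕ) • (nMul S M m).mkQ (b m)
    rw [← map_nsmul]
    rfl

theorem exists_eq_of_add_nsmul {x : ZAdicCompletion S M} {n : ℕ+} {a : M}
    (h : x.1 n = (nMul S M n).mkQ a) : ∃ y, x = of S M a + (n : ℕ) • y := by
  obtain ⟨y, hy⟩ := exists_eq_nsmul htf (x := x - of S M a) (n := n)
    (by change x.1 n - (of S M a).1 n = 0; rw [h, of_apply, sub_self])
  exact ⟨y, by rw [← hy]; abel⟩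

/-- The image of `M` is dense in its completion. -/
theorem exists_of_add_nsmul (x : ZAdicCompletion S M) {n : ℕ} (hn : 0 < n) :
    ∃ a y, x = of S M a + n • y := by
  obtain ⟨a, ha⟩ := (nMul S M n).mkQ_surjective (x.1 ⟨n, hn⟩)
  obtain ⟨y, hy⟩ := exists_eq_of_add_nsmul htf (n := ⟨n, hn⟩) ha.symm
  exact ⟨a, y, hy⟩

theorem eq_zero_of_nsmul {n : ℕ} (hn : n ≠ 0) {x : ZAdicCompletion S M} (h : n • x = 0) :
    x = 0 := by
  refine eq_zero_of_forall_dvd fun m hm => ?_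
  obtain ⟨a, y, rfl⟩ := exists_of_add_nsmul htf x hm
  have h1 : of S M (n • a) = (n * m) • (-y) := by
    rw [smul_add, ← mul_smul] at h
    rw [map_nsmul, smul_neg]
    exact eq_neg_of_add_eq_zero_left h
  obtain ⟨b, hb⟩ := exists_nsmul_of_of_eq (Nat.mul_pos (Nat.pos_of_ne_zero hn) hm) h1
  have h2 : a = m • b := sub_eq_zero.1 (htf n hn _ (by rw [smul_sub, hb, mul_smul, sub_self]))
  exact ⟨of S M b + y, by rw [h2, map_nsmul, smul_add]⟩

end TorsionFree

theorem padicInt_eq_zero_of_forall_dvd {z : ℤ_[2]} (h : ∀ k : ℕ, (2 : ℤ_[2]) ^ k ∣ z) : z = 0 := by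
  refine PadicInt.ext_of_toZModPow.1 fun n => ?_
  obtain ⟨c, rfl⟩ := h n
  rw [map_zero, ← RingHom.mem_ker, PadicInt.ker_toZModPow, Ideal.mem_span_singleton]
  exact_mod_cast dvd_mul_right _ _

/-- An additive functional on `M` extends to an additive map from the completion of `M` to the
`2`-adic integers. -/
theorem exists_extend (htf : ∀ n : ℕ, n ≠ 0 → ∀ a : M, n • a = 0 → a = 0) (f : M →+ ℤ) :
    ∃ F : ZAdicCompletion S M →+ ℤ_[2], ∀ a, F (of S M a) = (f a : ℤ_[2]) := by
  -- `F x` is the limit of `f (a k)`, where `a k` is any approximation of `x` modulo `2 ^ k`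
  have ex : ∀ x : ZAdicCompletion S M, ∃ z : ℤ_[2], ∀ (k : ℕ) (a : M) (y : ZAdicCompletion S M),
      x = of S M a + 2 ^ k • y → (2 : ℤ_[2]) ^ k ∣ z - (f a : ℤ_[2]) := by
    intro x
    choose a y hay using fun k : ℕ => exists_of_add_nsmul htf x (n := 2 ^ k) (by positivity)
    have cong : ∀ (k : ℕ) (b : M) (w : ZAdicCompletion S M) (b' : M) (w' : ZAdicCompletion S M),
        of S M b + 2 ^ k • w = of S M b' + 2 ^ k • w' → (2 : ℤ) ^ k ∣ f b - f b' := by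
      intro k b w b' w' h
      obtain ⟨c, hc⟩ := exists_nsmul_of_of_eq (n := 2 ^ k) (a := b - b') (y := w' - w)
        (by positivity) (by
          rw [map_sub, smul_sub, sub_eq_sub_iff_add_eq_add, h]; abel)
      exact ⟨f c, by rw [← map_sub, hc, map_nsmul]; simp⟩
    have hi : ∀ i, ((2 : ℕ) : ℤ) ^ i ∣ f (a (i + 1)) - f (a i) := fun i => by
      refine cong i _ (2 • y (i + 1)) _ (y i) ?_
      rw [← hay i, ← mul_smul, ← pow_succ, ← hay (i + 1)]
    refine ⟨PadicInt.ofIntSeq _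
      (PadicInt.isCauSeq_padicNorm_of_pow_dvd_sub (fun i => f (a i)) 2 hi), fun k b w hb => ?_⟩
    have h1 := PadicInt.toZModPow_ofIntSeq_of_pow_dvd_sub (fun i => f (a i)) 2 hi k
    have h2 : (2 : ℤ) ^ k ∣ f (a k) - f b := cong k _ (y k) _ w (by rw [← hay k, hb])
    have h3 : ((f (a k) : ℤ) : ZMod (2 ^ k)) = (f b : ℤ) := by
      rw [← sub_eq_zero, ← Int.cast_sub, ZMod.intCast_zmod_eq_zero_iff_dvd]
      exact_mod_cast h2
    have h4 := (PadicInt.ker_toZModPow (p := 2) k).le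
      (RingHom.sub_mem_ker_iff (PadicInt.toZModPow k) |>.2
        ((h1.trans h3).trans (map_intCast (PadicInt.toZModPow (p := 2) k) (f b)).symm))
    rw [Ideal.mem_span_singleton] at h4
    exact_mod_cast h4
  choose F hF using ex
  have uniq : ∀ x z, (∀ (k : ℕ) (a : M) (y : ZAdicCompletion S M),
      x = of S M a + 2 ^ k • y → (2 : ℤ_[2]) ^ k ∣ z - (f a : ℤ_[2])) → F x = z := by
    intro x z hz
    refine sub_eq_zero.1 (padicInt_eq_zero_of_forall_dvd fun k => ?_)
    obtain ⟨a, y, hay⟩ := exists_of_add_nsmul htf x (n := 2 ^ k) (by positivity)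
    have := dvd_sub (hF x k a y hay) (hz k a y hay)
    simpa using this
  have hof : ∀ a, F (of S M a) = (f a : ℤ_[2]) := fun a => by
    refine sub_eq_zero.1 (padicInt_eq_zero_of_forall_dvd fun k => ?_)
    exact hF _ k a 0 (by simp)
  refine ⟨AddMonoidHom.mk' F fun x x' => ?_, hof⟩
  refine sub_eq_zero.1 (padicInt_eq_zero_of_forall_dvd fun k => ?_)
  obtain ⟨a, y, hay⟩ := exists_of_add_nsmul htf x (n := 2 ^ k) (by positivity)
  obtain ⟨a', y', hay'⟩ := exists_of_add_nsmul htf x' (n := 2 ^ k) (by positivity)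
  have h1 := hF x k a y hay
  have h2 := hF x' k a' y' hay'
  have h3 := hF (x + x') k (a + a') (y + y') (by rw [hay, hay', map_add, smul_add]; abel)
  have := dvd_sub h3 (dvd_add h1 h2)
  rw [map_add, Int.cast_add] at this
  convert this using 1
  ring

/-- For a `2`-adic integer `α`, there is an integer congruent to `α` modulo the `2`-part of `n` and
divisible by the odd part of `n`; it is unique modulo `n`. -/
theorem exists_int_approx (α : ℤ_[2]) (n : ℕ+) : ∃ u : ℤ, ∀ k m : ℕ, (n : ℕ) = 2 ^ k * m → ¬ 2 ∣ m →
    (2 : ℤ_[2]) ^ k ∣ α - u ∧ (m : ℤ) ∣ u := by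
  obtain ⟨k, m, hm, hn⟩ := Nat.exists_eq_two_pow_mul_odd n.ne_zero
  -- if `x 2 ^ k + y m = 1`, then `y m` is an idempotent modulo `n` selecting the `2`-component
  have hcop : IsCoprime ((2 : ℤ) ^ k) (m : ℤ) := by
    refine IsCoprime.pow_left ?_
    have := (Nat.coprime_two_left).2 hm
    exact_mod_cast Nat.isCoprime_iff_coprime.2 this
  obtain ⟨x, y, hxy⟩ := hcop
  refine ⟨α.appr k * (y * m), fun k' m' hn' hm' => ?_⟩
  have hk : k' = k ∧ m' = m := by
    have h2 : ¬ 2 ∣ m := by rwa [Nat.two_dvd_ne_zero, ← Nat.odd_iff]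
    have e1 : padicValNat 2 n = k := by
      rw [hn, padicValNat.mul (by positivity) (by rintro rfl; simp at h2),
        padicValNat.prime_pow, padicValNat.eq_zero_of_not_dvd h2, add_zero]
    have e2 : padicValNat 2 n = k' := by
      rw [hn', padicValNat.mul (by positivity) (by rintro rfl; simp at hm'),
        padicValNat.prime_pow, padicValNat.eq_zero_of_not_dvd hm', add_zero]
    have e3 := e2.symm.trans e1
    subst e3
    exact ⟨rfl, Nat.eq_of_mul_eq_mul_left (by positivity) (hn'.symm.trans hn)⟩
  obtain ⟨rfl, rfl⟩ := hk
  constructor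
  · have h1 : (2 : ℤ_[2]) ^ k' ∣ α - α.appr k' := by
      have := PadicInt.appr_spec k' α
      rw [Ideal.mem_span_singleton] at this
      exact_mod_cast this
    have h2 : (y * m' : ℤ) = 1 - x * 2 ^ k' := by linarith
    rw [h2]
    have h3 : α - ((((α.appr k' : ℕ) : ℤ) * (1 - x * 2 ^ k') : ℤ) : ℤ_[2]) =
        (α - α.appr k') + 2 ^ k' * (α.appr k' * x) := by
      push_cast
      ring
    rw [h3]
    exact dvd_add h1 (dvd_mul_right _ _)
  · exact ⟨α.appr k' * y, by ring⟩

theorem int_dvd_of_padicInt_dvd {k : ℕ} {u : ℤ} (h : (2 : ℤ_[2]) ^ k ∣ (u : ℤ_[2])) :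
    (2 : ℤ) ^ k ∣ u := by
  have h1 : PadicInt.toZModPow (p := 2) k u = 0 := by
    rw [← RingHom.mem_ker, PadicInt.ker_toZModPow, Ideal.mem_span_singleton]
    exact_mod_cast h
  rw [map_intCast, ZMod.intCast_zmod_eq_zero_iff_dvd] at h1
  exact_mod_cast h1

/-- Multiplication by the element of `∏ p, ℤ_p` whose `2`-component is `α` and whose other
components vanish, as a map from `M` to its completion. It is described by its approximations
modulo the powers of `2`, which are integer multiplications. -/
theorem exists_padic_smul (htf : ∀ n : ℕ, n ≠ 0 → ∀ a : M, n • a = 0 → a = 0) (α : ℤ_[2]) :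
    ∃ s : M →ₗ[S] ZAdicCompletion S M, ∀ k : ℕ, ∃ u : ℤ, (2 : ℤ_[2]) ^ k ∣ α - u ∧
      ∀ a, ∃ y, s a = of S M (u • a) + 2 ^ k • y := by
  choose u hu using exists_int_approx α
  -- congruences modulo `m` are checked separately modulo its `2`-part and modulo its odd part
  have compat : ∀ m n : ℕ+, (m : ℕ) ∣ n → (m : ℤ) ∣ u n - u m := by
    intro m n hmn
    obtain ⟨k, m', hm', hm⟩ := Nat.exists_eq_two_pow_mul_odd m.ne_zero
    obtain ⟨l, n', hn', hn⟩ := Nat.exists_eq_two_pow_mul_odd n.ne_zero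
    have hm2 : ¬ 2 ∣ m' := by rwa [Nat.two_dvd_ne_zero, ← Nat.odd_iff]
    have hn2 : ¬ 2 ∣ n' := by rwa [Nat.two_dvd_ne_zero, ← Nat.odd_iff]
    have h1 := hu m k m' hm hm2
    have h2 := hu n l n' hn hn2
    rw [hm, hn] at hmn
    have hkl : k ≤ l := by
      have h3 : 2 ^ k ∣ 2 ^ l := Nat.Coprime.dvd_of_dvd_mul_right
        (Nat.Coprime.pow_left _ (Nat.coprime_two_left.2 hn')) ((dvd_mul_right _ _).trans hmn)
      exact (Nat.pow_dvd_pow_iff_le_right (by norm_num)).1 h3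
    have hmn' : m' ∣ n' := Nat.Coprime.dvd_of_dvd_mul_left
      (Nat.Coprime.pow_right _ (Nat.coprime_two_right.2 hm')) ((dvd_mul_left _ _).trans hmn)
    rw [hm]
    push_cast
    refine IsCoprime.mul_dvd ?_ ?_ ?_
    · refine IsCoprime.pow_left ?_
      exact_mod_cast Nat.isCoprime_iff_coprime.2 ((Nat.coprime_two_left).2 hm')
    · refine int_dvd_of_padicInt_dvd ?_
      have h4 := dvd_sub h1.1 ((pow_dvd_pow _ hkl).trans h2.1)
      rw [Int.cast_sub]
      convert h4 using 1
      ring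
    · exact dvd_sub ((Int.natCast_dvd_natCast.2 hmn').trans h2.2) h1.2
  refine ⟨{ toFun := fun a => ⟨fun n => (nMul S M n).mkQ (u n • a), fun m n h => ?_⟩
            map_add' := fun a b => ext_apply fun n => ?_
            map_smul' := fun c a => ext_apply fun n => ?_ }, fun k => ⟨u (2 ^ k), ?_, fun a => ?_⟩⟩
  · obtain ⟨c, hc⟩ := compat m n h
    refine (Submodule.Quotient.eq _).2 (mem_nMul.2 ⟨c • a, ?_⟩)
    rw [LinearMap.id_apply, ← sub_smul, hc, mul_smul, natCast_zsmul]
  · change (nMul S M n).mkQ (u n • (a + b)) = (nMul S M n).mkQ _ + (nMul S M n).mkQ _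
    rw [smul_add, map_add]
  · change (nMul S M n).mkQ (u n • (c • a)) = c • (nMul S M n).mkQ _
    rw [smul_comm, map_smul]
  · exact (hu (2 ^ k) k 1 (by simp) (by norm_num)).1
  · simpa using exists_eq_of_add_nsmul htf (n := 2 ^ k) (a := u (2 ^ k) • a) rfl

end ZAdicCompletion

/-! ### Algebraically independent `2`-adic integers -/

/-- A transcendence basis of the `2`-adic integers over `ℤ` is uncountable, by cardinality. -/
theorem exists_algebraicIndependent_padicInt (ι : Type) [Countable ι] :
    ∃ x : ι → ℤ_[2], AlgebraicIndependent ℤ x := by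
  obtain ⟨κ, y, hy⟩ := exists_isTranscendenceBasis' ℤ ℤ_[2]
  have h1 : Cardinal.aleph0 < Cardinal.mk ℤ_[2] := by
    have h2 : Cardinal.mk ℚ_[2] = Cardinal.mk ℤ_[2] := IsFractionRing.cardinalMk ℤ_[2] ℚ_[2]
    rw [← h2]
    exact Cardinal.aleph0_lt_continuum.trans_le
      (continuum_le_cardinal_of_nontriviallyNormedField ℚ_[2])
  have h3 : Cardinal.aleph0 < Cardinal.mk κ := by
    by_contra hcon
    push Not at hcon
    rcases isEmpty_or_nonempty κ with hκ | hκ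
    · have := hy.isEmpty_iff_isAlgebraic.1 hκ
      have h4 := Algebra.IsAlgebraic.cardinalMk_le_max ℤ ℤ_[2]
      rw [Cardinal.mk_int, max_self] at h4
      exact h1.not_ge h4
    · have h4 := hy.lift_cardinalMk_eq_max_lift
      simp at h4
      rw [h4] at h1
      simp [hcon] at h1
  obtain ⟨⟨e, he⟩⟩ : Nonempty (ι ↪ κ) := by
    rw [← Cardinal.lift_mk_le']
    refine (Cardinal.lift_le_aleph0.2 (Cardinal.mk_le_aleph0_iff.2 inferInstance)).trans ?_
    rw [Cardinal.aleph0_le_lift]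
    exact h3.le
  exact ⟨y ∘ e, hy.1.comp e he⟩

section Coefficients

variable {ι : Type*} {x : ι ⊕ ι → ℤ_[2]} (hx : AlgebraicIndependent ℤ x)
include hx

/-- A quadratic relation between algebraically independent elements remains valid after any
specialization. -/
theorem AlgebraicIndependent.specialize (s : Finset ι) (a : ι)
    {p q w : ℤ} {p₁ p₂ q₁ q₂ w₁ w₂ : ι → ℤ}
    (h : (p : ℤ_[2]) + ∑ c ∈ s, (x (.inl c) * p₁ c + x (.inr c) * p₂ c) =
      x (.inl a) * (q + ∑ c ∈ s, (x (.inl c) * q₁ c + x (.inr c) * q₂ c)) +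
      x (.inr a) * (w + ∑ c ∈ s, (x (.inl c) * w₁ c + x (.inr c) * w₂ c)))
    (v : ι ⊕ ι → ℤ) :
    p + ∑ c ∈ s, (v (.inl c) * p₁ c + v (.inr c) * p₂ c) =
      v (.inl a) * (q + ∑ c ∈ s, (v (.inl c) * q₁ c + v (.inr c) * q₂ c)) +
      v (.inr a) * (w + ∑ c ∈ s, (v (.inl c) * w₁ c + v (.inr c) * w₂ c)) := by
  open MvPolynomial in
  let L (p : ℤ) (p₁ p₂ : ι → ℤ) : MvPolynomial (ι ⊕ ι) ℤ :=
    C p + ∑ c ∈ s, (X (.inl c) * C (p₁ c) + X (.inr c) * C (p₂ c))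
  let P : MvPolynomial (ι ⊕ ι) ℤ := L p p₁ p₂ -
    (MvPolynomial.X (.inl a) * L q q₁ q₂ + MvPolynomial.X (.inr a) * L w w₁ w₂)
  have hP : P = 0 := by
    refine hx.eq_zero_of_aeval_eq_zero P ?_
    simp only [P, L, map_sub, map_add, map_mul, map_sum, MvPolynomial.aeval_X,
      MvPolynomial.aeval_C]
    simp only [algebraMap_int_eq, eq_intCast]
    rw [h, sub_self]
  have := congrArg (MvPolynomial.eval v) hP
  simp only [P, L, map_sub, map_add, map_mul, map_sum, MvPolynomial.eval_X,
    MvPolynomial.eval_C, map_zero] at this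
  exact sub_eq_zero.1 this

variable [DecidableEq ι]

/-- The constant term and the coefficients of the `α_c` vanish in an affine relation between the
`α_c` and the `β_c`. -/
theorem AlgebraicIndependent.linear_relation (s : Finset ι)
    {p : ℤ} {p₁ p₂ : ι → ℤ}
    (h : (p : ℤ_[2]) + ∑ c ∈ s, (x (.inl c) * p₁ c + x (.inr c) * p₂ c) = 0) :
    p = 0 ∧ ∀ a ∈ s, p₁ a = 0 := by
  rcases s.eq_empty_or_nonempty with rfl | ⟨a, ha⟩
  · simpa using h
  have key := hx.specialize s a (q := 0) (w := 0) (q₁ := 0) (q₂ := 0) (w₁ := 0) (w₂ := 0)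
    (by simpa using h)
  have h0 := key 0
  simp at h0
  refine ⟨h0, fun b hb => ?_⟩
  have h1 := key (Sum.elim (Pi.single b 1) 0)
  simpa [h0, Pi.single_apply, hb] using h1

/-- Comparison of coefficients in a relation `L_p = α_a L_q + β_a L_w` with `L_p`, `L_q`, `L_w`
affine forms in the `α_c`, `β_c`. -/
theorem AlgebraicIndependent.quadratic_relation (s : Finset ι) {a : ι} (ha : a ∈ s)
    {p q w : ℤ} {p₁ p₂ q₁ q₂ w₁ w₂ : ι → ℤ}
    (h : (p : ℤ_[2]) + ∑ c ∈ s, (x (.inl c) * p₁ c + x (.inr c) * p₂ c) =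
      x (.inl a) * (q + ∑ c ∈ s, (x (.inl c) * q₁ c + x (.inr c) * q₂ c)) +
      x (.inr a) * (w + ∑ c ∈ s, (x (.inl c) * w₁ c + x (.inr c) * w₂ c))) :
    (∀ c ∈ s, q₁ c = 0) ∧ (q₂ a = 0 → ∀ c ∈ s, w₁ c = 0) ∧ p₁ a = q ∧ p₂ a = w := by
  -- each coefficient is isolated by specializing at most two of the variables to `±1` and the
  -- remaining ones to `0`
  have key := hx.specialize s a h
  have h0 : p = 0 := by simpa using key 0
  have h1 := key (Sum.elim (Pi.single a 1) 0)
  have h2 := key (Sum.elim (Pi.single a (-1)) 0)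
  have h3 := key (Sum.elim 0 (Pi.single a 1))
  have h4 := key (Sum.elim 0 (Pi.single a (-1)))
  have h5 := key (Sum.elim (Pi.single a 1) (Pi.single a 1))
  simp [h0, Pi.single_apply, ha, Finset.sum_add_distrib] at h1 h2 h3 h4 h5
  -- the mixed monomials `α_a α_c` and `β_a α_c`
  have h6 : ∀ c ∈ s, c ≠ a → p₁ c = 0 ∧ q₁ c = 0 ∧ w₁ c = 0 := by
    intro c hc hca
    have h7 := key (Sum.elim (Pi.single c 1) 0)
    have h8 := key (Sum.elim (Pi.single c 1 + Pi.single a 1) 0)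
    have h9 := key (Sum.elim (Pi.single c 1) (Pi.single a 1))
    simp [h0, Pi.single_apply, ha, hc, hca.symm, Finset.sum_add_distrib, add_mul] at h7 h8 h9
    refine ⟨h7, ?_, ?_⟩ <;> linarith
  refine ⟨fun c hc => ?_, fun hq c hc => ?_, by linarith, by linarith⟩
  · by_cases hca : c = a
    · subst hca; linarith
    · exact (h6 c hc hca).2.1
  · by_cases hca : c = a
    · subst hca; linarith
    · exact (h6 c hc hca).2.2

end Coefficients

/-! ### Existence of Corner groups -/

namespace CornerHat

variable {r : ℕ}

/-- The canonical map from Corner's ring to its completion. -/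
abbrev of (r : ℕ) : CornerRing r →ₗ[(CornerRing r)ᵐᵒᵖ] CornerHat r :=
  ZAdicCompletion.of (CornerRing r)ᵐᵒᵖ (CornerRing r)

theorem eq_zero_of_nsmul {n : ℕ} (hn : n ≠ 0) {x : CornerHat r} (h : n • x = 0) : x = 0 :=
  ZAdicCompletion.eq_zero_of_nsmul CornerRing.torsionFree hn h

theorem nsmul_right_injective {n : ℕ} (hn : n ≠ 0) {x y : CornerHat r} (h : n • x = n • y) :
    x = y :=
  sub_eq_zero.1 (eq_zero_of_nsmul hn (by rw [smul_sub, h, sub_self]))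

theorem of_injective : Function.Injective (of r) := by
  refine (injective_iff_map_eq_zero _).2 fun a ha => ?_
  refine CornerRing.eq_zero_of_forall_dvd fun n hn => ?_
  exact ZAdicCompletion.exists_nsmul_of_of_eq (S := (CornerRing r)ᵐᵒᵖ) hn (y := 0)
    (by rw [smul_zero]; exact ha)

theorem smul_of (b : (CornerRing r)ᵐᵒᵖ) (a : CornerRing r) : b • of r a = of r (a * unop b) :=
  ((of r).map_smul b a).symm

theorem smul_one_eq (b : (CornerRing r)ᵐᵒᵖ) : b • one r = of r (unop b) := by
  rw [one, smul_of, one_mul]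

theorem pureClosure_countable (N : Submodule (CornerRing r)ᵐᵒᵖ (CornerHat r)) [Countable N] :
    Countable (pureClosure N) := by
  have h : (pureClosure N : Set (CornerHat r)) ⊆
      ⋃ n : ℕ, (fun x : CornerHat r => (n + 1) • x) ⁻¹' (N : Set (CornerHat r)) := by
    rintro x ⟨n, hn, hx⟩
    refine Set.mem_iUnion.2 ⟨n - 1, ?_⟩
    change (n - 1 + 1) • x ∈ N
    rwa [Nat.sub_add_cancel hn]
  refine Set.Countable.mono h (Set.countable_iUnion fun n => ?_)
  exact (Set.to_countable (N : Set (CornerHat r))).preimage_of_injOn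
    (Function.Injective.injOn fun x y => nsmul_right_injective n.succ_ne_zero)

theorem nsmul_mem_of_dvd {N : Submodule (CornerRing r)ᵐᵒᵖ (CornerHat r)} {m n : ℕ} (h : m ∣ n)
    {x : CornerHat r} (hx : m • x ∈ N) : n • x ∈ N := by
  obtain ⟨c, rfl⟩ := h
  rw [mul_comm, mul_smul]
  exact N.nsmul_mem hx c

theorem le_pureClosure (N : Submodule (CornerRing r)ᵐᵒᵖ (CornerHat r)) : N ≤ pureClosure N :=
  fun x hx => ⟨1, one_pos, by simpa using hx⟩

theorem mem_pureClosure_of_nsmul {N : Submodule (CornerRing r)ᵐᵒᵖ (CornerHat r)} {n : ℕ}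
    (hn : 0 < n) {x : CornerHat r} (h : n • x ∈ pureClosure N) : x ∈ pureClosure N := by
  obtain ⟨m, hm, h⟩ := h
  exact ⟨m * n, Nat.mul_pos hm hn, by rwa [mul_smul]⟩

theorem of_mem {G : Submodule (CornerRing r)ᵐᵒᵖ (CornerHat r)} (h1 : one r ∈ G)
    (a : CornerRing r) : of r a ∈ G := by
  have := G.smul_mem (op a) h1
  rwa [smul_one_eq] at this

/-- Multiplication of an element of Corner's ring by a `2`-adic integer, with values in the
completion; the components at the odd primes are set to zero. -/
noncomputable def padicSmul (z : ℤ_[2]) : CornerRing r →ₗ[(CornerRing r)ᵐᵒᵖ] CornerHat r :=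
  (ZAdicCompletion.exists_padic_smul (S := (CornerRing r)ᵐᵒᵖ) (M := CornerRing r)
    CornerRing.torsionFree z).choose

theorem padicSmul_spec (z : ℤ_[2]) (k : ℕ) : ∃ u : ℤ, (2 : ℤ_[2]) ^ k ∣ z - u ∧
    ∀ a : CornerRing r, ∃ y, padicSmul z a = of r (u • a) + 2 ^ k • y :=
  (ZAdicCompletion.exists_padic_smul (S := (CornerRing r)ᵐᵒᵖ) (M := CornerRing r)
    CornerRing.torsionFree z).choose_spec k

/-- The continuous extension of a functional on Corner's ring to its completion, with values in
the `2`-adic integers. -/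
noncomputable def extend (f : CornerRing r →+ ℤ) : CornerHat r →+ ℤ_[2] :=
  (ZAdicCompletion.exists_extend (S := (CornerRing r)ᵐᵒᵖ) (M := CornerRing r)
    CornerRing.torsionFree f).choose

theorem extend_of (f : CornerRing r →+ ℤ) (a : CornerRing r) : extend f (of r a) = (f a : ℤ_[2]) :=
  (ZAdicCompletion.exists_extend (S := (CornerRing r)ᵐᵒᵖ) (M := CornerRing r)
    CornerRing.torsionFree f).choose_spec a

theorem extend_padicSmul (f : CornerRing r →+ ℤ) (z : ℤ_[2]) (a : CornerRing r) :
    extend f (padicSmul z a) = z * (f a : ℤ_[2]) := by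
  refine sub_eq_zero.1 (ZAdicCompletion.padicInt_eq_zero_of_forall_dvd fun k => ?_)
  obtain ⟨u, hu, hy⟩ := padicSmul_spec (r := r) z k
  obtain ⟨y, hy⟩ := hy a
  rw [hy, map_add, extend_of, map_nsmul, map_zsmul]
  have : ((u • f a : ℤ) : ℤ_[2]) + (2 ^ k • extend f y) - z * (f a : ℤ_[2]) =
      2 ^ k * extend f y - (z - u) * f a := by
    simp only [smul_eq_mul, nsmul_eq_mul]
    push_cast
    ring
  rw [this]
  exact dvd_sub (dvd_mul_right _ _) (hu.mul_right _)

/-- The elements `e_c = α_c 1 + β_c c` of the completion, together with `1`, for a family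
`(α, β)` of `2`-adic integers. -/
noncomputable def family (x : CornerRing r ⊕ CornerRing r → ℤ_[2]) :
    Option (CornerRing r) → CornerHat r
  | none => one r
  | some c => padicSmul (x (.inl c)) 1 + padicSmul (x (.inr c)) c

theorem extend_linearCombination (x : CornerRing r ⊕ CornerRing r → ℤ_[2]) (f : CornerRing r →+ ℤ)
    (l : Option (CornerRing r) →₀ (CornerRing r)ᵐᵒᵖ) {t : Finset (CornerRing r)}
    (ht : l.some.support ⊆ t) :
    extend f (Finsupp.linearCombination (CornerRing r)ᵐᵒᵖ (family x) l) =
      (f (unop (l none)) : ℤ_[2]) + ∑ c ∈ t, (x (.inl c) * f (unop (l (some c))) +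
        x (.inr c) * f (c * unop (l (some c)))) := by
  rw [Finsupp.linearCombination_option, map_add, Finsupp.linearCombination_apply,
    Finsupp.sum_of_support_subset _ ht _ (by simp), map_sum]
  congr 1
  · change extend f (l none • one r) = _
    rw [smul_one_eq, extend_of]
  · refine Finset.sum_congr rfl fun c _ => ?_
    change extend f (l (some c) • (padicSmul (x (.inl c)) 1 + padicSmul (x (.inr c)) c)) = _
    rw [smul_add, ← map_smul, ← map_smul, map_add, extend_padicSmul, extend_padicSmul]
    simp

theorem linearIndependent_family {x : CornerRing r ⊕ CornerRing r → ℤ_[2]}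
    (hx : AlgebraicIndependent ℤ x) : LinearIndependent (CornerRing r)ᵐᵒᵖ (family x) := by
  classical
  refine linearIndependent_iff.2 fun l hl => ?_
  have h1 := fun f => hx.linear_relation l.some.support
    ((extend_linearCombination x f l subset_rfl).symm.trans (by rw [hl, map_zero]))
  ext o
  refine congrArg op (CornerRing.eq_zero_of_forall_hom fun f => ?_)
  cases o with
  | none => exact (h1 f).1
  | some c =>
    by_cases hc : c ∈ l.some.support
    · exact (h1 f).2 c hc
    · have hc' : l (some c) = 0 := by
        by_contra h
        exact hc (Finsupp.mem_support_iff.2 h)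
      exact (congrArg (fun z => f (unop z)) hc').trans (map_zero f)

/-- The pure closure of the free module on `1` and the `e_c`. -/
noncomputable def cornerGroup (x : CornerRing r ⊕ CornerRing r → ℤ_[2]) :
    Submodule (CornerRing r)ᵐᵒᵖ (CornerHat r) :=
  pureClosure (Submodule.span (CornerRing r)ᵐᵒᵖ (Set.range (family x)))

section CornerGroup

variable {x : CornerRing r ⊕ CornerRing r → ℤ_[2]}

theorem family_mem (o : Option (CornerRing r)) : family x o ∈ cornerGroup x :=
  le_pureClosure _ (Submodule.subset_span ⟨o, rfl⟩)

theorem one_mem : one r ∈ cornerGroup x := family_mem none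

/-- The relation `θ(e_a) = α_a θ(1) + β_a θ(a)` for the `2`-adic coordinates, multiplied by `n`. It
holds because `θ` is continuous for the `ℤ`-adic topology: modulo `2 ^ k`, the scalars `α_a` and
`β_a` are integers. -/
theorem extend_endo_family (θ : cornerGroup x →+ cornerGroup x) (a : CornerRing r) (n : ℕ)
    (f : CornerRing r →+ ℤ) :
    extend f (n • (θ ⟨family x (some a), family_mem _⟩ : CornerHat r)) =
      x (.inl a) * extend f (n • (θ ⟨of r 1, of_mem one_mem 1⟩ : CornerHat r)) +
      x (.inr a) * extend f (n • (θ ⟨of r a, of_mem one_mem a⟩ : CornerHat r)) := by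
  refine sub_eq_zero.1 (ZAdicCompletion.padicInt_eq_zero_of_forall_dvd fun k => ?_)
  obtain ⟨α, hα, h1⟩ := padicSmul_spec (r := r) (x (.inl a)) k
  obtain ⟨β, hβ, h2⟩ := padicSmul_spec (r := r) (x (.inr a)) k
  obtain ⟨y₁, h1⟩ := h1 1
  obtain ⟨y₂, h2⟩ := h2 a
  have h3 : family x (some a) = α • of r 1 + β • of r a + 2 ^ k • (y₁ + y₂) := by
    change padicSmul (x (.inl a)) 1 + padicSmul (x (.inr a)) a = _
    rw [h1, h2, map_zsmul, map_zsmul, smul_add]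
    abel
  have hy : y₁ + y₂ ∈ cornerGroup x := by
    refine mem_pureClosure_of_nsmul (n := 2 ^ k) (by positivity) ?_
    have h4 : 2 ^ k • (y₁ + y₂) = family x (some a) - (α • of r 1 + β • of r a) := by
      rw [h3]; abel
    rw [h4]
    exact (cornerGroup x).sub_mem (family_mem _) ((cornerGroup x).add_mem
      (zsmul_mem (of_mem one_mem 1) α) (zsmul_mem (of_mem one_mem a) β))
  have h5 : (⟨family x (some a), family_mem _⟩ : cornerGroup x) =
      α • ⟨of r 1, of_mem one_mem 1⟩ + β • ⟨of r a, of_mem one_mem a⟩ +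
        2 ^ k • ⟨y₁ + y₂, hy⟩ := Subtype.ext h3
  have hsmul : ∀ (m : ℤ) (g : cornerGroup x), θ (m • g) = m • θ g := map_zsmul θ
  have hnsmul : ∀ (m : ℕ) (g : cornerGroup x), θ (m • g) = m • θ g := map_nsmul θ
  rw [h5, map_add, map_add, hsmul, hsmul, hnsmul]
  generalize θ ⟨of r 1, of_mem one_mem 1⟩ = A, θ ⟨of r a, of_mem one_mem a⟩ = B,
    θ ⟨y₁ + y₂, hy⟩ = C
  have h6 : extend f (n • ((α • A + β • B + 2 ^ k • C : cornerGroup x) : CornerHat r)) =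
      α * extend f (n • (A : CornerHat r)) + β * extend f (n • (B : CornerHat r)) +
        2 ^ k * extend f (n • (C : CornerHat r)) := by
    push_cast
    simp only [smul_add, map_add, map_nsmul, map_zsmul, nsmul_eq_mul, zsmul_eq_mul]
    push_cast
    ring
  rw [h6]
  have h7 : ∀ A B C a' b' : ℤ_[2], a' * A + b' * B + 2 ^ k * C -
      (x (.inl a) * A + x (.inr a) * B) =
      2 ^ k * C - ((x (.inl a) - a') * A + (x (.inr a) - b') * B) := by
    intros; ring
  rw [h7]
  exact dvd_sub (dvd_mul_right _ _) (dvd_add (hα.mul_right _) (hβ.mul_right _))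

theorem linearCombination_eq_of {l : Option (CornerRing r) →₀ (CornerRing r)ᵐᵒᵖ}
    (hl : ∀ c, l (some c) = 0) :
    Finsupp.linearCombination (CornerRing r)ᵐᵒᵖ (family x) l = of r (unop (l none)) := by
  have : l.some = 0 := by ext c; simp [hl]
  rw [Finsupp.linearCombination_option, this, map_zero, add_zero]
  exact smul_one_eq _

/-- Comparing coefficients of the monomials in the `α_c` and `β_c` in the relation
`θ e_a = α_a θ(1) + β_a θ(a)`, one finds that `θ(1)` lies in Corner's ring and `θ(a) = a θ(1)`. -/
theorem endo_of (hx : AlgebraicIndependent ℤ x) (θ : cornerGroup x →+ cornerGroup x)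
    (a : CornerRing r) :
    ∃ y, (θ ⟨of r 1, of_mem one_mem 1⟩ : CornerHat r) = of r y ∧
      (θ ⟨of r a, of_mem one_mem a⟩ : CornerHat r) = of r (a * y) := by
  classical
  have rel := extend_endo_family θ a
  generalize θ ⟨family x (some a), family_mem _⟩ = A, θ ⟨of r 1, of_mem one_mem 1⟩ = B,
    θ ⟨of r a, of_mem one_mem a⟩ = C at rel
  obtain ⟨n₁, hn₁, h₁⟩ := A.2
  obtain ⟨n₂, hn₂, h₂⟩ := B.2
  obtain ⟨n₃, hn₃, h₃⟩ := C.2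
  -- a common multiple that moves all three values into the span of the family
  obtain ⟨n, hn, d₁, d₂, d₃⟩ : ∃ n : ℕ, 0 < n ∧ n₁ ∣ n ∧ n₂ ∣ n ∧ n₃ ∣ n :=
    ⟨n₁ * n₂ * n₃, by positivity, ⟨n₂ * n₃, by ring⟩, ⟨n₁ * n₃, by ring⟩, ⟨n₁ * n₂, by ring⟩⟩
  have hmem : ∀ y ∈ Submodule.span (CornerRing r)ᵐᵒᵖ (Set.range (family x)),
      ∃ l, Finsupp.linearCombination (CornerRing r)ᵐᵒᵖ (family x) l = y := by
    intro y hy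
    rw [← Finsupp.range_linearCombination] at hy
    exact hy
  obtain ⟨p, hp⟩ := hmem _ (nsmul_mem_of_dvd d₁ h₁)
  obtain ⟨q, hq⟩ := hmem _ (nsmul_mem_of_dvd d₂ h₂)
  obtain ⟨w, hw⟩ := hmem _ (nsmul_mem_of_dvd d₃ h₃)
  let t : Finset (CornerRing r) :=
    insert a (p.some.support ∪ q.some.support ∪ w.some.support)
  have hat : a ∈ t := Finset.mem_insert_self _ _
  have htp : p.some.support ⊆ t := fun c hc => by
    simp only [t, Finset.mem_insert, Finset.mem_union]; tauto
  have htq : q.some.support ⊆ t := fun c hc => by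
    simp only [t, Finset.mem_insert, Finset.mem_union]; tauto
  have htw : w.some.support ⊆ t := fun c hc => by
    simp only [t, Finset.mem_insert, Finset.mem_union]; tauto
  have cmp := fun f => hx.quadratic_relation t hat (by
    have := rel n f
    rw [← hp, ← hq, ← hw, extend_linearCombination x f p htp, extend_linearCombination x f q htq,
      extend_linearCombination x f w htw] at this
    exact this)
  -- the quadratic monomials show that the multiples of `θ(1)` and `θ(a)` have no component at
  -- any `e_c`, the linear ones compare the remaining coefficients
  have hq0 : ∀ c, q (some c) = 0 := by
    intro c
    by_cases hc : c ∈ t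
    · exact congrArg op (CornerRing.eq_zero_of_forall_hom fun f => (cmp f).1 c hc)
    · by_contra h
      exact hc (htq (Finsupp.mem_support_iff.2 h))
  have hw0 : ∀ c, w (some c) = 0 := by
    intro c
    by_cases hc : c ∈ t
    · exact congrArg op (CornerRing.eq_zero_of_forall_hom fun f =>
        (cmp f).2.1 (by simp [hq0]) c hc)
    · by_contra h
      exact hc (htw (Finsupp.mem_support_iff.2 h))
  have hpq : unop (p (some a)) = unop (q none) :=
    sub_eq_zero.1 (CornerRing.eq_zero_of_forall_hom fun f => by
      rw [map_sub, sub_eq_zero]; exact (cmp f).2.2.1)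
  have hpw : a * unop (p (some a)) = unop (w none) :=
    sub_eq_zero.1 (CornerRing.eq_zero_of_forall_hom fun f => by
      rw [map_sub, sub_eq_zero]; exact (cmp f).2.2.2)
  rw [linearCombination_eq_of hq0] at hq
  rw [linearCombination_eq_of hw0] at hw
  obtain ⟨y, hy⟩ := ZAdicCompletion.exists_nsmul_of_of_eq hn hq
  refine ⟨y, nsmul_right_injective hn.ne' ?_, nsmul_right_injective hn.ne' ?_⟩
  · rw [← hq, hy, map_nsmul]
  · rw [← hw, ← hpw, hpq, hy, mul_smul_comm, map_nsmul]

/-- An additive endomorphism which is right multiplication by `y` on Corner's ring is so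
everywhere, by density. -/
theorem endo_eq_smul (θ : cornerGroup x →+ cornerGroup x) (y : CornerRing r)
    (h : ∀ a, (θ ⟨of r a, of_mem one_mem a⟩ : CornerHat r) = of r (a * y)) (g : cornerGroup x) :
    θ g = op y • g := by
  refine Subtype.ext (sub_eq_zero.1 ?_)
  refine ZAdicCompletion.eq_zero_of_forall_dvd fun n hn => ?_
  obtain ⟨b, z, hz⟩ :=
    ZAdicCompletion.exists_of_add_nsmul CornerRing.torsionFree (g : CornerHat r) hn
  have hzG : z ∈ cornerGroup x := by
    refine mem_pureClosure_of_nsmul hn ?_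
    have : n • z = g - of r b := by rw [hz]; abel
    rw [this]
    exact (cornerGroup x).sub_mem g.2 (of_mem one_mem b)
  have hg : g = ⟨of r b, of_mem one_mem b⟩ + n • ⟨z, hzG⟩ := Subtype.ext hz
  refine ⟨θ ⟨z, hzG⟩ - op y • z, ?_⟩
  have h1 : (θ g : CornerHat r) = of r (b * y) + n • (θ ⟨z, hzG⟩ : CornerHat r) := by
    rw [hg, map_add, map_nsmul, ← h b]
    rfl
  have h2 : ((op y • g : cornerGroup x) : CornerHat r) = of r (b * y) + n • (op y • z) := by
    change op y • (g : CornerHat r) = _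
    rw [hz, smul_add, smul_of, unop_op, smul_comm]
  rw [h1, h2, smul_sub]
  abel

end CornerGroup

instance : Countable (CornerRing r)ᵐᵒᵖ := opEquiv.symm.injective.countable

theorem isCornerGroup_cornerGroup {x : CornerRing r ⊕ CornerRing r → ℤ_[2]}
    (hx : AlgebraicIndependent ℤ x) : IsCornerGroup r (cornerGroup x) := by
  refine ⟨pureClosure_countable _, ?_, ⟨Set.range (family x), ⟨none, rfl⟩,
    (linearIndependent_family hx).linearIndepOn_id, rfl⟩, ?_, ?_⟩
  · refine ⟨fun n hn y y' h => Subtype.ext ?_⟩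
    exact nsmul_right_injective hn (congrArg Subtype.val h)
  · refine (injective_iff_map_eq_zero _).2 fun a ha => ?_
    have h1 : a • (⟨one r, one_mem⟩ : cornerGroup x) = 0 := DFunLike.congr_fun ha _
    have h2 : a • one r = 0 := congrArg Subtype.val h1
    rw [smul_one_eq, ← map_zero (of r)] at h2
    exact unop_injective (of_injective h2)
  · intro θ
    obtain ⟨y, hy, -⟩ := endo_of hx θ 0
    refine ⟨op y, AddMonoidHom.ext fun g => (endo_eq_smul θ y (fun a => ?_) g).symm⟩
    obtain ⟨y', h1, h2⟩ := endo_of hx θ a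
    rw [h2, of_injective (hy.symm.trans h1)]

end CornerHat

theorem exists_isCornerGroup (r : ℕ) :
    ∃ G : Submodule (CornerRing r)ᵐᵒᵖ (CornerHat r), IsCornerGroup r G := by
  obtain ⟨x, hx⟩ := exists_algebraicIndependent_padicInt (CornerRing r ⊕ CornerRing r)
  exact ⟨_, CornerHat.isCornerGroup_cornerGroup hx⟩

/-! ### Homomorphisms to `ℤ` and isomorphisms between powers -/

/-- A trace on a ring `R` with values in `ℤ / r` obstructs the existence of mutually inverse
rectangular matrices over `R` whose sizes are not congruent modulo `r`. -/
theorem natCast_eq_of_matrix_inverse {R : Type*} [Ring R] {r : ℕ} (T : R →+ ZMod r) (hT1 : T 1 = 1)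
    (hT : ∀ a b, T (a * b) = T (b * a)) {m k : ℕ} (P : Matrix (Fin m) (Fin k) R)
    (Q : Matrix (Fin k) (Fin m) R) (h1 : P * Q = 1) (h2 : Q * P = 1) : (m : ZMod r) = k := by
  have e1 : T (P * Q).trace = m := by
    rw [h1, Matrix.trace_one, Fintype.card_fin, ← nsmul_one, map_nsmul, hT1, nsmul_one]
  have e2 : T (Q * P).trace = k := by
    rw [h2, Matrix.trace_one, Fintype.card_fin, ← nsmul_one, map_nsmul, hT1, nsmul_one]
  rw [← e1, ← e2]
  simp only [Matrix.trace, Matrix.diag_apply, Matrix.mul_apply, map_sum]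
  rw [Finset.sum_comm]
  exact Finset.sum_congr rfl fun i _ => Finset.sum_congr rfl fun j _ => hT _ _

/-- If every additive endomorphism of `G` is multiplication by a unique element of `R`, additive
isomorphisms between finite powers of `G` are given by invertible matrices over `R`. -/
theorem exists_matrix_inverse {R G : Type*} [Ring R] [AddCommGroup G] [Module R G]
    (hG : Function.Bijective (Module.toAddMonoidEnd R G)) {m k : ℕ}
    (φ : (Fin m → G) ≃+ (Fin k → G)) :
    ∃ (P : Matrix (Fin m) (Fin k) R) (Q : Matrix (Fin k) (Fin m) R), P * Q = 1 ∧ Q * P = 1 := by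
  have ex : ∀ {m k : ℕ} (φ : (Fin m → G) →+ (Fin k → G)), ∃ P : Matrix (Fin k) (Fin m) R,
      ∀ x i, φ x i = ∑ j, P i j • x j := by
    intro m k φ
    choose P hP using fun i j => hG.2
      ((Pi.evalAddMonoidHom (fun _ => G) i).comp (φ.comp (AddMonoidHom.single (fun _ => G) j)))
    refine ⟨P, fun x i => ?_⟩
    have hx : x = ∑ j, Pi.single j (x j) := (Finset.univ_sum_single x).symm
    conv_lhs => rw [hx, map_sum, Finset.sum_apply]
    exact Finset.sum_congr rfl fun j _ => (DFunLike.congr_fun (hP i j) (x j)).symm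
  have one : ∀ {m k : ℕ} (φ : (Fin m → G) →+ (Fin k → G)) (ψ : (Fin k → G) →+ (Fin m → G))
      (_ : ∀ x, φ (ψ x) = x) (P : Matrix (Fin k) (Fin m) R) (Q : Matrix (Fin m) (Fin k) R)
      (_ : ∀ x i, φ x i = ∑ j, P i j • x j) (_ : ∀ x i, ψ x i = ∑ j, Q i j • x j),
      P * Q = 1 := by
    intro m k φ ψ h P Q hP hQ
    ext i j
    refine hG.1 (AddMonoidHom.ext fun g => ?_)
    change (P * Q) i j • g = (1 : Matrix (Fin k) (Fin k) R) i j • g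
    have h1 := congrFun (h (Pi.single j g)) i
    rw [hP] at h1
    simp only [hQ, Pi.single_apply, smul_ite, smul_zero, Finset.sum_ite_eq', Finset.mem_univ,
      if_true] at h1
    rw [Matrix.mul_apply, Finset.sum_smul]
    simp only [mul_smul]
    rw [h1, Matrix.one_apply]
    split_ifs <;> simp
  obtain ⟨Q, hQ⟩ := ex φ.toAddMonoidHom
  obtain ⟨P, hP⟩ := ex φ.symm.toAddMonoidHom
  exact ⟨P, Q, one _ _ (fun x => φ.symm_apply_apply x) P Q hP hQ,
    one _ _ (fun x => φ.apply_symm_apply x) Q P hQ hP⟩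

/-- A group `G` without nonzero homomorphisms to `ℤ` can be cancelled against free groups. -/
theorem nonempty_addEquiv_of_prod {G : Type*} [AddCommGroup G] (hG : ∀ f : G →+ ℤ, f = 0)
    {m k : ℕ} (Φ : ((Fin m → G) × (ℕ →₀ ℤ)) ≃+ ((Fin k → G) × (ℕ →₀ ℤ))) :
    Nonempty ((Fin m → G) ≃+ (Fin k → G)) := by
  have zero : ∀ {m : ℕ} (f : (Fin m → G) →+ (ℕ →₀ ℤ)), f = 0 := by
    intro m f
    ext i g n
    exact DFunLike.congr_fun (hG ((Finsupp.applyAddHom n).comp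
      (f.comp (AddMonoidHom.single (fun _ => G) i)))) g
  have inl : ∀ {m k : ℕ} (Φ : ((Fin m → G) × (ℕ →₀ ℤ)) ≃+ ((Fin k → G) × (ℕ →₀ ℤ))) (x),
      Φ (x, 0) = ((Φ (x, 0)).1, 0) := by
    intro m k Φ x
    refine Prod.ext rfl ?_
    exact DFunLike.congr_fun (zero ((AddMonoidHom.snd _ _).comp
      (Φ.toAddMonoidHom.comp (AddMonoidHom.inl (Fin m → G) (ℕ →₀ ℤ))))) x
  exact ⟨
    { toFun := fun x => (Φ (x, 0)).1
      invFun := fun x => (Φ.symm (x, 0)).1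
      left_inv := fun x => by dsimp only; rw [← inl Φ x, Φ.symm_apply_apply]
      right_inv := fun x => by dsimp only; rw [← inl Φ.symm x, Φ.apply_symm_apply]
      map_add' := fun x y => by
        rw [← Prod.fst_add, ← map_add, Prod.mk_add_mk, add_zero] }⟩

namespace IsCornerGroup

variable {r : ℕ} {G : Submodule (CornerRing r)ᵐᵒᵖ (CornerHat r)} (hG : IsCornerGroup r G)
include hG

theorem one_mem : CornerHat.one r ∈ G := by
  obtain ⟨E, hE, -, rfl⟩ := hG.eq_pureClosure
  exact CornerHat.le_pureClosure _ (Submodule.subset_span hE)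

/-- A nonzero homomorphism `f` to `ℤ` yields the endomorphism `g ↦ f(g) 1`, which must be
multiplication by the integer `f(1)`. Applied to `σ_0`, this makes `f(1) σ_0` an integer, which
forces `f(1) = 0`. -/
theorem hom_int_eq_zero (hr : 0 < r) (f : G →+ ℤ) : f = 0 := by
  let u : G := ⟨CornerHat.one r, hG.one_mem⟩
  -- the endomorphism `g ↦ f(g) 1`
  obtain ⟨a, ha⟩ := hG.end_eq.2 (((zmultiplesHom G) u).comp f)
  have ha : ∀ g : G, a • (g : CornerHat r) = f g • CornerHat.one r := fun g =>
    congrArg Subtype.val (DFunLike.congr_fun ha g)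
  have hint : ∀ z : ℤ, z • CornerHat.one r = CornerHat.of r z := fun z => by
    rw [CornerHat.one, ← map_zsmul, zsmul_one]
  have ha1 : a = op ((f u : ℤ) : CornerRing r) := by
    have := ha u
    rw [hint, CornerHat.smul_one_eq] at this
    exact unop_injective (CornerHat.of_injective this)
  subst ha1
  let s : G := ⟨CornerHat.of r (CornerRing.sigma 0), CornerHat.of_mem hG.one_mem _⟩
  have hs := ha s
  rw [hint, CornerHat.smul_of] at hs
  have hs : CornerRing.sigma 0 * ((f u : ℤ) : CornerRing r) = ((f s : ℤ) : CornerRing r) :=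
    CornerHat.of_injective hs
  have h01 : (0 : Fin (r + 1)) ≠ Fin.last r := fun h => hr.ne (congrArg Fin.val h)
  -- `σ_0 f(1) = f(σ_0)`, multiplied by `ρ_r` on the left and by `σ_r` on the right
  have hfs : ((f s : ℤ) : CornerRing r) = 0 := by
    have h1 : CornerRing.rho (Fin.last r) * (f s : CornerRing r) * CornerRing.sigma (Fin.last r) =
        0 := by rw [← hs, ← mul_assoc, CornerRing.rho_mul_sigma, if_neg h01, zero_mul, zero_mul]
    rwa [← Int.cast_comm, mul_assoc, CornerRing.rho_mul_sigma, if_pos rfl, mul_one] at h1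
  have hfu : ((f u : ℤ) : CornerRing r) = 0 := by
    have h1 := congrArg (CornerRing.rho 0 * ·) hs
    simpa only [← mul_assoc, CornerRing.rho_mul_sigma, if_true, one_mul, hfs, mul_zero] using h1
  ext g
  have h1 := ha g
  rw [hfu, op_zero, zero_smul, hint, ← map_zero (CornerHat.of r)] at h1
  have h2 := congrArg (CornerRing.eps r) (CornerHat.of_injective h1)
  rw [← zsmul_one, map_zero, map_zsmul, CornerRing.eps_one] at h2
  simpa using h2.symm

theorem isEmpty_addEquiv (hr : 0 < r) {m k : ℕ} (hmk : ¬ m ≡ k [MOD r]) :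
    IsEmpty (((Fin m → G) × (ℕ →₀ ℤ)) ≃+ ((Fin k → G) × (ℕ →₀ ℤ))) := by
  refine ⟨fun Φ => hmk ?_⟩
  obtain ⟨φ⟩ := nonempty_addEquiv_of_prod (hG.hom_int_eq_zero hr) Φ
  obtain ⟨P, Q, h1, h2⟩ := exists_matrix_inverse hG.end_eq φ
  obtain ⟨T, hT1, hT⟩ := CornerRing.exists_trace r
  rw [← ZMod.natCast_eq_natCast_iff]
  exact natCast_eq_of_matrix_inverse (T.comp (opAddEquiv (α := CornerRing r)).symm.toAddMonoidHom)
    hT1 (fun a b => hT _ _) P Q h1 h2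

end IsCornerGroup

/-! ### The mapping telescope of a sequence of free modules -/

theorem isFreeOfRankOmega_of_basis {R ι : Type*} [Ring R] [Countable ι] [Infinite ι]
    {M : Type*} [AddCommGroup M] [Module R M] (b : Module.Basis ι R M) : IsFreeOfRankOmega R M := by
  obtain ⟨e⟩ := nonempty_equiv_of_countable (α := ι) (β := ℕ)
  exact ⟨b.reindex e⟩

namespace Telescope

variable {R L G : Type*} [Ring R] [AddCommGroup L] [Module R L] [AddCommGroup G] [Module R G]
  (φ : ℕ → L →ₗ[R] L) (g : ℕ → L →ₗ[R] G)

/-- The endomorphism `x ↦ x - φ x` of `⨁ n, L`, where `φ` raises the index by one: its cokernel is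
the direct limit of the sequence `φ n : L → L`. -/
noncomputable def diff : (ℕ →₀ L) →ₗ[R] (ℕ →₀ L) :=
  LinearMap.id - Finsupp.lsum ℕ fun n => (Finsupp.lsingle (n + 1)).comp (φ n)

theorem diff_single (n : ℕ) (l : L) :
    diff φ (Finsupp.single n l) = Finsupp.single n l - Finsupp.single (n + 1) (φ n l) := by
  simp [diff]

theorem diff_apply_zero (x : ℕ →₀ L) : diff φ x 0 = x 0 := by
  induction x using Finsupp.induction_linear with
  | zero => simp
  | add x y hx hy => simp [hx, hy]
  | single n l => simp [diff_single]

theorem diff_apply_succ (x : ℕ →₀ L) (n : ℕ) : diff φ x (n + 1) = x (n + 1) - φ n (x n) := by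
  induction x using Finsupp.induction_linear with
  | zero => simp
  | add x y hx hy => simp only [map_add, Finsupp.add_apply, hx, hy]; abel
  | single m l =>
    rw [diff_single, Finsupp.sub_apply]
    congr 1
    by_cases h : m = n
    · subst h; simp
    · simp [h]

/-- `diff φ` is unitriangular: the first components of `x` can be recovered from those of
`diff φ x`. -/
theorem eq_zero_of_diff {x : ℕ →₀ L} {n : ℕ} (h : ∀ k < n, diff φ x k = 0) :
    ∀ k < n, x k = 0 := by
  intro k
  induction k with
  | zero => intro hk; rw [← diff_apply_zero φ, h 0 hk]
  | succ k ih =>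
    intro hk
    have := h (k + 1) hk
    rwa [diff_apply_succ, ih (by omega), map_zero, sub_zero] at this

theorem diff_injective : Function.Injective (diff φ) := by
  refine (injective_iff_map_eq_zero _).2 fun x hx => Finsupp.ext fun n => ?_
  exact eq_zero_of_diff φ (n := n + 1) (fun k _ => by simp [hx]) n (by omega)

/-- The image under `diff` of the first `n` summands. -/
noncomputable def stage (n : ℕ) : Submodule R (ℕ →₀ L) :=
  (Finsupp.supported L R (Set.Iio n)).map (diff φ)

theorem stage_mono : Monotone (stage φ) := fun _ _ h =>
  Submodule.map_mono (Finsupp.supported_mono (Set.Iio_subset_Iio h))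

theorem stage_zero : stage φ 0 = ⊥ := by
  have : Set.Iio (0 : ℕ) = ∅ := by ext; simp
  rw [stage, this, Finsupp.supported_empty, Submodule.map_bot]

theorem range_diff_eq : ((LinearMap.range (diff φ) : Submodule R (ℕ →₀ L)) : Set (ℕ →₀ L)) =
    ⋃ n, (stage φ n : Set (ℕ →₀ L)) := by
  ext x
  simp only [Set.mem_iUnion, SetLike.mem_coe]
  constructor
  · rintro ⟨y, rfl⟩
    obtain ⟨n, hn⟩ := y.support.bddAbove
    refine ⟨n + 1, ⟨y, fun k hk => Nat.lt_succ_of_le (hn hk), rfl⟩⟩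
  · rintro ⟨n, y, -, rfl⟩
    exact ⟨y, rfl⟩

/-- Modulo the `n`-th stage, an element of an index at most `n` can be moved to index `n`. -/
theorem exists_single_sub_mem {n k : ℕ} (hk : k ≤ n) (l : L) :
    ∃ l', Finsupp.single k l - Finsupp.single n l' ∈ stage φ n := by
  induction n, hk using Nat.le_induction with
  | base => exact ⟨l, by simp⟩
  | succ n hkn ih =>
    obtain ⟨l', h⟩ := ih
    refine ⟨φ n l', ?_⟩
    have h1 : diff φ (Finsupp.single n l') ∈ stage φ (n + 1) :=
      ⟨_, Finsupp.single_mem_supported R l' (Nat.lt_succ_self n), rfl⟩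
    have := (stage φ (n + 1)).add_mem (stage_mono φ n.le_succ h) h1
    rw [diff_single] at this
    convert this using 1
    abel

theorem exists_sub_mem (n : ℕ) (x : ℕ →₀ L) :
    ∃ y ∈ Finsupp.supported L R (Set.Ici n), x - y ∈ stage φ n := by
  induction x using Finsupp.induction_linear with
  | zero => exact ⟨0, zero_mem _, by simp⟩
  | add x y hx hy =>
    obtain ⟨x', h1, h2⟩ := hx
    obtain ⟨y', h3, h4⟩ := hy
    refine ⟨x' + y', add_mem h1 h3, ?_⟩
    rw [add_sub_add_comm]
    exact add_mem h2 h4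
  | single k l =>
    rcases le_total k n with h | h
    · obtain ⟨l', hl⟩ := exists_single_sub_mem φ h l
      exact ⟨_, Finsupp.single_mem_supported R l' (Set.self_mem_Ici), hl⟩
    · exact ⟨_, Finsupp.single_mem_supported R l h, by simp⟩

/-- The summands of index at least `n` form a complement of the `n`-th stage. -/
theorem nonempty_quotient_stage_equiv (n : ℕ) :
    Nonempty (Finsupp.supported L R (Set.Ici n) ≃ₗ[R] (ℕ →₀ L) ⧸ stage φ n) := by
  refine ⟨LinearEquiv.ofBijective ((stage φ n).mkQ.comp (Submodule.subtype _)) ⟨?_, ?_⟩⟩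
  · refine (injective_iff_map_eq_zero _).2 fun x hx => ?_
    obtain ⟨y, hy, hyx⟩ := (Submodule.Quotient.mk_eq_zero _).1 hx
    have hx0 : ∀ k < n, (x : ℕ →₀ L) k = 0 := fun k hk => by
      by_contra h
      exact absurd (x.2 (Finsupp.mem_support_iff.2 h)) (by simpa using hk)
    have hy0 : y = 0 := by
      ext k
      by_cases hk : k < n
      · exact eq_zero_of_diff φ (n := n) (fun k hk => by rw [hyx]; exact hx0 k hk) k hk
      · by_contra h
        exact hk (hy (Finsupp.mem_support_iff.2 h))
    rw [hy0, map_zero] at hyx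
    exact Subtype.ext hyx.symm
  · intro q
    obtain ⟨x, rfl⟩ := (stage φ n).mkQ_surjective q
    obtain ⟨y, hy, hxy⟩ := exists_sub_mem φ n x
    exact ⟨⟨y, hy⟩, ((Submodule.Quotient.eq _).2 hxy).symm⟩

theorem nonempty_stage_succ_quotient_equiv (n : ℕ) :
    Nonempty (L ≃ₗ[R] stage φ (n + 1) ⧸ (stage φ n).submoduleOf (stage φ (n + 1))) := by
  let f : L →ₗ[R] stage φ (n + 1) := ((diff φ).comp (Finsupp.lsingle n)).codRestrict _ fun l =>
    ⟨_, Finsupp.single_mem_supported R l (Nat.lt_succ_self n), rfl⟩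
  refine ⟨LinearEquiv.ofBijective ((Submodule.mkQ _).comp f) ⟨?_, ?_⟩⟩
  · refine (injective_iff_map_eq_zero _).2 fun l hl => ?_
    obtain ⟨y, hy, hyl⟩ := Submodule.mem_comap.1 ((Submodule.Quotient.mk_eq_zero _).1 hl)
    have h1 : y = Finsupp.single n l := diff_injective φ hyl
    by_contra hl0
    have : n ∈ y.support := by simpa [h1] using hl0
    exact lt_irrefl n (hy this)
  · intro q
    obtain ⟨⟨_, y, hy, rfl⟩, rfl⟩ := Submodule.mkQ_surjective _ q
    have hmem : y.erase n ∈ Finsupp.supported L R (Set.Iio n) := fun k hk => by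
      have hk' := Finsupp.mem_support_iff.1 hk
      have hkn : k ≠ n := by rintro rfl; simp at hk'
      rw [Finsupp.erase_ne hkn] at hk'
      have := hy (Finsupp.mem_support_iff.2 hk')
      simp at this ⊢
      omega
    have hsub : diff φ y - diff φ (Finsupp.single n (y n)) ∈ stage φ n := by
      refine ⟨y.erase n, hmem, ?_⟩
      rw [← map_sub]
      congr 1
      exact eq_sub_of_add_eq (Finsupp.erase_add_single n y)
    refine ⟨y n, Eq.symm ?_⟩
    refine (Submodule.Quotient.eq ((stage φ n).submoduleOf (stage φ (n + 1)))).2 ?_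
    exact hsub

/-- If the maps `g n : L → G` are compatible with the `φ n` and their kernels die after one step,
then the range of `diff` is the kernel of the induced map `⨁ n, L → G`: modulo this range, any
element is concentrated in a single index. -/
theorem ker_lsum_eq (h1 : ∀ n l, g (n + 1) (φ n l) = g n l) (h2 : ∀ n l, g n l = 0 → φ n l = 0) :
    LinearMap.ker (Finsupp.lsum ℕ g) = LinearMap.range (diff φ) := by
  have hd : ∀ y, Finsupp.lsum ℕ g (diff φ y) = 0 := by
    intro y
    induction y using Finsupp.induction_linear with
    | zero => simp
    | add x y hx hy => rw [map_add, map_add, hx, hy, add_zero]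
    | single n l => rw [diff_single, map_sub]; simp [h1]
  refine le_antisymm (fun x hx => ?_) ?_
  · obtain ⟨n, hn⟩ := x.support.bddAbove
    have key : ∀ s : Finset ℕ, (∀ k ∈ s, k ≤ n) → ∀ x : ℕ →₀ L,
        ∃ l, (∑ k ∈ s, Finsupp.single k (x k)) - Finsupp.single n l ∈ LinearMap.range (diff φ) := by
      intro s hs x
      choose! l hl using fun k (hk : k ∈ s) => exists_single_sub_mem φ (hs k hk) (x k)
      refine ⟨∑ k ∈ s, l k, ?_⟩
      have : Finsupp.single n (∑ k ∈ s, l k) = ∑ k ∈ s, Finsupp.single n (l k) :=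
        map_sum (Finsupp.singleAddHom n) _ _
      rw [this, ← Finset.sum_sub_distrib]
      refine Submodule.sum_mem _ fun k hk => ?_
      obtain ⟨y, -, hy⟩ := hl k hk
      exact ⟨y, hy⟩
    obtain ⟨l, hl⟩ := key x.support (fun k hk => hn hk) x
    have hxs : ∑ k ∈ x.support, Finsupp.single k (x k) = x := Finsupp.sum_single x
    rw [hxs] at hl
    have hg : g n l = 0 := by
      obtain ⟨y, hy⟩ := hl
      have := hd y
      rw [hy, map_sub, LinearMap.mem_ker.1 hx] at this
      simpa using this
    have h3 : Finsupp.single n l ∈ LinearMap.range (diff φ) :=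
      ⟨Finsupp.single n l, by rw [diff_single, h2 n l hg]; simp⟩
    simpa using Submodule.add_mem _ hl h3
  · rintro _ ⟨y, rfl⟩
    exact hd y

end Telescope

/-- A direct limit of a sequence of free modules of rank `ω`, presented as a quotient `H / B` of
countable free modules with `B` the union of a chain of free submodules with free quotients. The
kernel of each map to the limit is assumed to be killed after a single step. -/
theorem exists_telescope {R L G : Type} [Ring R] [Countable R] [AddCommGroup L] [Module R L]
    [AddCommGroup G] [Module R G] (b : Module.Basis ℕ R L) (φ : ℕ → L →ₗ[R] L)
    (g : ℕ → L →ₗ[R] G) (h1 : ∀ n l, g (n + 1) (φ n l) = g n l)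
    (h2 : ∀ n l, g n l = 0 → φ n l = 0) (h3 : ∀ x, ∃ n l, g n l = x) :
    ∃ (H : Type) (_ : AddCommGroup H) (_ : Module R H) (B : Submodule R H)
      (Bn : ℕ → Submodule R H),
      Countable H ∧ Module.Free R H ∧ Countable B ∧ Module.Free R B ∧
      Nonempty (G ≃ₗ[R] H ⧸ B) ∧ Monotone Bn ∧ (B : Set H) = ⋃ n, (Bn n : Set H) ∧ Bn 0 = ⊥ ∧
      ∀ n, Module.Free R (Bn n) ∧ IsFreeOfRankOmega R (H ⧸ Bn n) ∧
        IsFreeOfRankOmega R (Bn (n + 1) ⧸ (Bn n).submoduleOf (Bn (n + 1))) := by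
  have hL : Countable L := b.repr.toEquiv.countable_iff.2 inferInstance
  have hLf : Module.Free R L := Module.Free.of_basis b
  have hsup : ∀ s : Set ℕ, Module.Free R (Finsupp.supported L R s) := fun s =>
    Module.Free.of_equiv (Finsupp.supportedEquivFinsupp (M := L) (R := R) s).symm
  refine ⟨ℕ →₀ L, inferInstance, inferInstance, LinearMap.range (Telescope.diff φ),
    Telescope.stage φ, inferInstance, inferInstance, inferInstance, ?_, ?_,
    Telescope.stage_mono φ, Telescope.range_diff_eq φ, Telescope.stage_zero φ,
    fun n => ⟨?_, ?_, ?_⟩⟩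
  · exact Module.Free.of_equiv (LinearEquiv.ofInjective _ (Telescope.diff_injective φ))
  · rw [← Telescope.ker_lsum_eq φ g h1 h2]
    refine ⟨(LinearMap.quotKerEquivOfSurjective _ fun x => ?_).symm⟩
    obtain ⟨n, l, rfl⟩ := h3 x
    exact ⟨Finsupp.single n l, by simp⟩
  · exact Module.Free.of_equiv
      (Submodule.equivMapOfInjective _ (Telescope.diff_injective φ) (Finsupp.supported L R _))
  · obtain ⟨e⟩ := Telescope.nonempty_quotient_stage_equiv φ n
    have : Infinite (Set.Ici n) := (Set.Ici_infinite n).to_subtype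
    exact isFreeOfRankOmega_of_basis ((Finsupp.basis fun _ : Set.Ici n => b).map
      ((Finsupp.supportedEquivFinsupp (M := L) (R := R) _).symm.trans e))
  · obtain ⟨e⟩ := Telescope.nonempty_stage_succ_quotient_equiv φ n
    exact ⟨b.map e⟩

/-- The presentation of `exists_telescope` for a module which is the union of an increasing
sequence of countable free submodules, with bases indexed by the same set. -/
theorem exists_presentation_of_chain {R G ι : Type} [Ring R] [Countable R] [AddCommGroup G]
    [Module R G] [Countable ι] (w : ℕ → ι → G) (hw : ∀ n, LinearIndependent R (w n))
    (hmono : ∀ n i, w n i ∈ Submodule.span R (Set.range (w (n + 1))))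
    (hunion : ∀ x, ∃ n, x ∈ Submodule.span R (Set.range (w n))) :
    ∃ (H : Type) (_ : AddCommGroup H) (_ : Module R H) (B : Submodule R H)
      (Bn : ℕ → Submodule R H),
      Countable H ∧ Module.Free R H ∧ Countable B ∧ Module.Free R B ∧
      Nonempty (G ≃ₗ[R] H ⧸ B) ∧ Monotone Bn ∧ (B : Set H) = ⋃ n, (Bn n : Set H) ∧ Bn 0 = ⊥ ∧
      ∀ n, Module.Free R (Bn n) ∧ IsFreeOfRankOmega R (H ⧸ Bn n) ∧
        IsFreeOfRankOmega R (Bn (n + 1) ⧸ (Bn n).submoduleOf (Bn (n + 1))) := by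
  have hmem : ∀ n x, x ∈ Submodule.span R (Set.range (w n)) →
      ∃ l, Finsupp.linearCombination R (w n) l = x := fun n x hx => by
    rw [← Finsupp.range_linearCombination] at hx
    exact hx
  choose t ht using fun n i => hmem (n + 1) _ (hmono n i)
  -- the summand `ℕ →₀ R`, on which all maps vanish, makes the rank infinite when `ι` is finite
  let b₀ : Module.Basis (ι ⊕ ℕ) R ((ι →₀ R) × (ℕ →₀ R)) :=
    Module.Basis.prod ⟨LinearEquiv.refl R _⟩ ⟨LinearEquiv.refl R _⟩
  obtain ⟨b⟩ := isFreeOfRankOmega_of_basis b₀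
  let ψ := fun n => Finsupp.linearCombination R (t n)
  have hψ : ∀ n l, Finsupp.linearCombination R (w (n + 1)) (ψ n l) =
      Finsupp.linearCombination R (w n) l := by
    intro n l
    rw [Finsupp.linearCombination_linearCombination]
    simp only [ht]
  refine exists_telescope b
    (fun n => (LinearMap.inl R _ _).comp ((ψ n).comp (LinearMap.fst R _ _)))
    (fun n => (Finsupp.linearCombination R (w n)).comp (LinearMap.fst R _ _)) ?_ ?_ ?_
  · intro n l
    exact hψ n l.1
  · intro n l hl
    have : l.1 = 0 := linearIndependent_iff.1 (hw n) _ hl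
    simp [this]
  · intro x
    obtain ⟨n, hn⟩ := hunion x
    obtain ⟨l, hl⟩ := hmem n x hn
    exact ⟨n, (l, 0), hl⟩

/-! ### Corner groups as unions of chains of free modules -/

/-- If `e i = a i + n y i` with `a i` in Corner's ring and the `e i` are linearly independent
together with `1`, then so are the `y i`: multiply a relation between the latter by `n`. -/
theorem CornerHat.linearIndependent_of_eq_add_nsmul {r n : ℕ} {ι : Type*}
    {e y : ι → CornerHat r} {a : ι → CornerRing r} (h : ∀ i, e i = of r (a i) + n • y i)
    (hv : LinearIndependent (CornerRing r)ᵐᵒᵖ (fun o : Option ι => o.elim (one r) e)) :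
    LinearIndependent (CornerRing r)ᵐᵒᵖ (fun o : Option ι => o.elim (one r) y) := by
  refine linearIndependent_iff.2 fun l hl => ?_
  rw [Finsupp.linearCombination_option, Finsupp.linearCombination_apply] at hl
  change l none • one r + l.some.sum (fun i c => c • y i) = 0 at hl
  let d : (CornerRing r)ᵐᵒᵖ := l.some.sum fun i c => c * op (a i)
  have hl0 := linearIndependent_iff.1 hv
    (Finsupp.single none (n • l none - d) + l.some.mapDomain some) (by
      rw [map_add, Finsupp.linearCombination_single, Finsupp.linearCombination_mapDomain,
        Finsupp.linearCombination_apply]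
      change (n • l none - d) • one r + l.some.sum (fun i c => c • e i) = 0
      have h2 : (l.some.sum fun i c => c • e i) =
          d • one r + n • l.some.sum fun i c => c • y i := by
        simp only [d, Finsupp.sum, Finset.sum_smul, mul_smul, Finset.smul_sum,
          ← Finset.sum_add_distrib]
        refine Finset.sum_congr rfl fun i _ => ?_
        rw [h, smul_add, smul_one_eq, unop_op, smul_comm n]
      have h3 : (n • l none - d) • one r = n • (l none • one r) - d • one r :=
        (sub_smul _ _ _).trans (congrArg (· - d • one r) (smul_assoc _ _ _))
      rw [h2, h3, ← add_assoc, sub_add_cancel, ← smul_add, hl, smul_zero])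
  have hsome : ∀ i, l (some i) = 0 := fun i => by
    have h2 := DFunLike.congr_fun hl0 (some i)
    rw [Finsupp.add_apply, Finsupp.mapDomain_apply (Option.some_injective ι),
      Finsupp.single_eq_of_ne (by simp), zero_add] at h2
    exact h2
  have hnone : l none • one r = 0 := by
    have h2 : l.some = 0 := Finsupp.ext hsome
    rwa [h2, Finsupp.sum_zero_index, add_zero] at hl
  rw [smul_one_eq, ← map_zero (of r)] at hnone
  refine Finsupp.ext fun o => ?_
  cases o with
  | none => exact unop_injective (of_injective hnone)
  | some i => exact hsome i

namespace IsCornerGroup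

variable {r : ℕ} {G : Submodule (CornerRing r)ᵐᵒᵖ (CornerHat r)} (hG : IsCornerGroup r G)
include hG

/-- Writing each basis element `e ≠ 1` as `a + n! y` with `a` in Corner's ring, the elements `1` and
`y` form a basis of a free submodule, and these submodules form a chain with union `G`. -/
theorem exists_chain : ∃ (ι : Type) (_ : Countable ι) (w : ℕ → ι → G),
    (∀ n, LinearIndependent (CornerRing r)ᵐᵒᵖ (w n)) ∧
    (∀ n i, w n i ∈ Submodule.span (CornerRing r)ᵐᵒᵖ (Set.range (w (n + 1)))) ∧
    ∀ x, ∃ n, x ∈ Submodule.span (CornerRing r)ᵐᵒᵖ (Set.range (w n)) := by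
  have hcount := hG.countable
  have h1G := hG.one_mem
  obtain ⟨E, hE1, hli, hGE⟩ := hG.eq_pureClosure
  have hEG : ∀ e ∈ E, e ∈ G := fun e he => by
    rw [hGE]; exact CornerHat.le_pureClosure _ (Submodule.subset_span he)
  let ι := {e : CornerHat r // e ∈ E ∧ e ≠ CornerHat.one r}
  have hι : Countable ι := by
    refine Function.Injective.countable (f := fun e : ι => (⟨e.1, hEG e.1 e.2.1⟩ : G)) ?_
    intro e e' h
    exact Subtype.ext (congrArg (fun x : G => (x : CornerHat r)) h)
  choose a y hay using fun (n : ℕ) (e : ι) => ZAdicCompletion.exists_of_add_nsmul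
    CornerRing.torsionFree e.1 n.factorial_pos
  have hyG : ∀ n e, y n e ∈ G := fun n e => by
    have h1 : n.factorial • y n e ∈ G := by
      have : n.factorial • y n e = e.1 - CornerHat.of r (a n e) := by
        conv_rhs => rw [hay n e]
        abel
      rw [this]
      exact G.sub_mem (hEG _ e.2.1) (CornerHat.of_mem h1G _)
    rw [hGE] at h1 ⊢
    exact CornerHat.mem_pureClosure_of_nsmul n.factorial_pos h1
  let w : ℕ → Option ι → G := fun n o => o.elim ⟨CornerHat.one r, h1G⟩ fun e => ⟨y n e, hyG n e⟩
  have hof : ∀ n c, (⟨CornerHat.of r c, CornerHat.of_mem h1G c⟩ : G) ∈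
      Submodule.span (CornerRing r)ᵐᵒᵖ (Set.range (w n)) := by
    intro n c
    have h1 : w n none ∈ Submodule.span (CornerRing r)ᵐᵒᵖ (Set.range (w n)) :=
      Submodule.subset_span ⟨none, rfl⟩
    have h2 : (⟨CornerHat.of r c, CornerHat.of_mem h1G c⟩ : G) = op c • w n none :=
      Subtype.ext (CornerHat.smul_one_eq (op c)).symm
    rw [h2]
    exact Submodule.smul_mem _ _ h1
  have hv : LinearIndependent (CornerRing r)ᵐᵒᵖ
      (fun o : Option ι => o.elim (CornerHat.one r) fun e => e.1) := by
    let j : Option ι → E := fun o => o.elim ⟨CornerHat.one r, hE1⟩ fun e => ⟨e.1, e.2.1⟩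
    have hj : Function.Injective j := by
      rintro (_ | e) (_ | e') h
      · rfl
      · exact absurd (congrArg Subtype.val h).symm e'.2.2
      · exact absurd (congrArg Subtype.val h) e.2.2
      · exact congrArg some (Subtype.ext (congrArg (fun x : E => (x : CornerHat r)) h))
    have h1 := LinearIndependent.comp hli j hj
    convert h1 using 1
    ext o : 1
    cases o <;> rfl
  refine ⟨Option ι, inferInstance, w, fun n => ?_, fun n o => ?_, fun x => ?_⟩
  · refine LinearIndependent.of_comp (Submodule.subtype G) ?_
    have h1 := CornerHat.linearIndependent_of_eq_add_nsmul
      (fun e : ι => hay n e) hv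
    convert h1 using 1
    ext o : 1
    cases o <;> rfl
  · cases o with
    | none => exact Submodule.subset_span ⟨none, rfl⟩
    | some e =>
      have h1 : CornerHat.of r (a (n + 1) e - a n e) =
          n.factorial • (y n e - (n + 1) • y (n + 1) e) := by
        have h2 := (hay n e).symm.trans (hay (n + 1) e)
        rw [map_sub, smul_sub, ← mul_smul, mul_comm, ← Nat.factorial_succ,
          sub_eq_sub_iff_add_eq_add, add_comm, add_comm (n.factorial • _)]
        exact (add_comm _ _).trans h2.symm
      obtain ⟨b, hb⟩ := ZAdicCompletion.exists_nsmul_of_of_eq n.factorial_pos h1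
      rw [hb, map_nsmul] at h1
      have h2 : y n e = (n + 1) • y (n + 1) e + CornerHat.of r b := by
        rw [CornerHat.nsmul_right_injective n.factorial_ne_zero h1]; abel
      have h3 : w n (some e) = (n + 1) • w (n + 1) (some e) +
          ⟨CornerHat.of r b, CornerHat.of_mem h1G b⟩ := Subtype.ext h2
      rw [h3]
      exact Submodule.add_mem _ (Submodule.smul_of_tower_mem _ _
        (Submodule.subset_span ⟨some e, rfl⟩)) (hof _ _)
  · obtain ⟨n, hn, hx⟩ : ∃ n : ℕ, 0 < n ∧ n • (x : CornerHat r) ∈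
        Submodule.span (CornerRing r)ᵐᵒᵖ E := hGE.le x.2
    -- modulo `A`, the span of `E` consists of `n!`-fold multiples of elements of the `n`-th module
    have key : ∀ h ∈ Submodule.span (CornerRing r)ᵐᵒᵖ E, ∃ c,
        ∃ z ∈ Submodule.span (CornerRing r)ᵐᵒᵖ (Set.range (w n)),
          h = CornerHat.of r c + n.factorial • (z : CornerHat r) := by
      intro h hh
      induction hh using Submodule.span_induction with
      | mem e he =>
        by_cases he1 : e = CornerHat.one r
        · exact ⟨1, 0, zero_mem _, by rw [he1]; simp [CornerHat.one]⟩
        · exact ⟨a n ⟨e, he, he1⟩, w n (some ⟨e, he, he1⟩), Submodule.subset_span ⟨_, rfl⟩,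
            hay n ⟨e, he, he1⟩⟩
      | zero => exact ⟨0, 0, zero_mem _, by simp⟩
      | add h h' _ _ ih ih' =>
        obtain ⟨c, z, hz, rfl⟩ := ih
        obtain ⟨c', z', hz', rfl⟩ := ih'
        refine ⟨c + c', z + z', add_mem hz hz', ?_⟩
        rw [map_add, Submodule.coe_add, smul_add]
        abel
      | smul s h _ ih =>
        obtain ⟨c, z, hz, rfl⟩ := ih
        refine ⟨c * unop s, s • z, Submodule.smul_mem _ _ hz, ?_⟩
        rw [smul_add, CornerHat.smul_of, Submodule.coe_smul, smul_comm]
    obtain ⟨c, z, hz, hxz⟩ := key _ hx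
    obtain ⟨m, hm⟩ := Nat.dvd_factorial hn le_rfl
    have h1 : CornerHat.of r c = n • ((x : CornerHat r) - m • z) := by
      rw [smul_sub, hxz, ← mul_smul, ← hm]; abel
    obtain ⟨b, rfl⟩ := ZAdicCompletion.exists_nsmul_of_of_eq hn h1
    rw [map_nsmul] at h1
    have h2 : (x : CornerHat r) = CornerHat.of r b + m • (z : CornerHat r) := by
      rw [CornerHat.nsmul_right_injective hn.ne' h1]; abel
    have h3 : x = ⟨CornerHat.of r b, CornerHat.of_mem h1G b⟩ + m • z := Subtype.ext h2
    refine ⟨n, ?_⟩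
    rw [h3]
    exact Submodule.add_mem _ (hof _ _) (Submodule.smul_of_tower_mem _ _ hz)

end IsCornerGroup

theorem proposition1p1 (r : ℕ) (hr : 0 < r) :
    (∃ G : Submodule (CornerRing r)ᵐᵒᵖ (CornerHat r), IsCornerGroup r G) ∧
    ∀ G : Submodule (CornerRing r)ᵐᵒᵖ (CornerHat r), IsCornerGroup r G →
      (∃ (H : Type) (_ : AddCommGroup H) (_ : Module (CornerRing r)ᵐᵒᵖ H)
          (B : Submodule (CornerRing r)ᵐᵒᵖ H) (Bn : ℕ → Submodule (CornerRing r)ᵐᵒᵖ H),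
        Countable H ∧ Module.Free (CornerRing r)ᵐᵒᵖ H ∧
        Countable B ∧ Module.Free (CornerRing r)ᵐᵒᵖ B ∧
        Nonempty (G ≃ₗ[(CornerRing r)ᵐᵒᵖ] H ⧸ B) ∧
        Monotone Bn ∧ (B : Set H) = ⋃ n, (Bn n : Set H) ∧ Bn 0 = ⊥ ∧
        ∀ n, Module.Free (CornerRing r)ᵐᵒᵖ (Bn n) ∧
          IsFreeOfRankOmega (CornerRing r)ᵐᵒᵖ (H ⧸ Bn n) ∧
          IsFreeOfRankOmega (CornerRing r)ᵐᵒᵖ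
            (Bn (n + 1) ⧸ (Bn n).submoduleOf (Bn (n + 1)))) ∧
      (∀ f : G →+ ℤ, f = 0) ∧
      ∀ m k : ℕ, 0 < m → 0 < k → ¬ m ≡ k [MOD r] →
        IsEmpty (((Fin m → G) × (ℕ →₀ ℤ)) ≃+ ((Fin k → G) × (ℕ →₀ ℤ))) := by
  refine ⟨exists_isCornerGroup r, fun G hG => ⟨?_, hG.hom_int_eq_zero hr,
    fun m k _ _ hmk => hG.isEmpty_addEquiv hr hmk⟩⟩
  obtain ⟨ι, _, w, hw, hmono, hunion⟩ := hG.exists_chain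
  exact exists_presentation_of_chain w hw hmono hunion
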